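/- Let $n\ge 2$, let $\mathfrak g=\mathfrak{sp}(2n,\mathbb C)$, and let $\mathfrak h$ be its Cartan subalgebra of diagonal matrices $\mathrm{diag}(a_1,\dots,a_n,-a_1,\dots,-a_n)$, with coordinate functionals $\epsilon_1,\dots,\epsilon_n\in\mathfrak h^*$, $\epsilon_i(\mathrm{diag}(a_1,\dots,a_n,-a_1,\dots,-a_n))=a_i$. Take as positive roots $\epsilon_i\pm\epsilon_j$ for $1\le i<j\le n$ and $2\epsilon_i$ for $1\le i\le n$, so that the fundamental weights are $\varpi_i=\epsilon_1+\dots+\epsilon_i$, $1\le i\le n$. For $\lambda\in\mathfrak h^*$ let $L(\lambda)$ be the irreducible highest weight $\mathfrak g$-module with highest weight $\lambda$, that is, the quotient of the Verma module with highest weight $\lambda$ by its largest proper submodule. Put $$A=\Bigl\{\sum_{i=1}^n\lambda_i\varpi_i \;\Big|\; \lambda_1,\dots,\lambda_{n-1}\in\mathbb N_0,\ \lambda_n\in\mathbb Z+\tfrac12,\ \lambda_{n-1}+2\lambda_n+3>0\Bigr\}\subseteq\mathfrak h^*,$$ and, for $\mu\in\mathfrak h^*$, $$A_\mu=A\cap\{\mu+\epsilon_i,\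 \mu-\epsilon_i \mid i=1,\dots,n\}.$$ Let $\mathfrak g$ act on $\mathbb C^{2n}$ by the defining representation. Then for every $\mu\in A$ there is an isomorphism of $\mathfrak g$-modules $$L(\mu)\otimes\mathbb C^{2n}\;\cong\;\bigoplus_{\lambda\in A_\mu}L(\lambda),$$ and every summand $L(\lambda)$, $\lambda\in A_\mu$, is an irreducible $\mathfrak g$-module. -/

import Mathlib

open scoped TensorProduct DirectSum

attribute [local instance 100] LieRing.ofAssociativeRing

noncomputable section

namespace SymplecticTensor

/-- The complex symplectic Lie algebra `sp(2n, ℂ)`: the matrices `[[P, Q], [R, -Pᵀ]]` with `Q`, `R`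
symmetric. It acts on `Fin n ⊕ Fin n → ℂ = ℂ²ⁿ` by matrix-vector multiplication (the defining
representation). -/
abbrev 𝔤 (n : ℕ) : LieSubalgebra ℂ (Matrix (Fin n ⊕ Fin n) (Fin n ⊕ Fin n) ℂ) :=
  LieAlgebra.Symplectic.sp (Fin n) ℂ

/-- The Cartan subalgebra of diagonal matrices in `sp(2n, ℂ)`, as a subspace; its elements are the
matrices `diag(a₁, …, aₙ, -a₁, …, -aₙ)`. -/
def 𝔥 (n : ℕ) : Submodule ℂ (𝔤 n) where
  carrier := {H | (H : Matrix (Fin n ⊕ Fin n) (Fin n ⊕ Fin n) ℂ).IsDiag}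
  add_mem' hX hY := by simpa using Matrix.IsDiag.add hX hY
  zero_mem' := by simp [Matrix.isDiag_zero]
  smul_mem' c X hX := by simpa using Matrix.IsDiag.smul c hX

/-- Weights: linear functionals on the Cartan subalgebra. -/
abbrev Wt (n : ℕ) : Type := Module.Dual ℂ (𝔥 n)

/-- The weight `ε_i : diag(a₁, …, aₙ, -a₁, …, -aₙ) ↦ a_i` (with `i` counted from `0`). -/
def ε {n : ℕ} (i : Fin n) : Wt n where
  toFun H := (H : Matrix (Fin n ⊕ Fin n) (Fin n ⊕ Fin n) ℂ) (Sum.inl i) (Sum.inl i)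
  map_add' _ _ := rfl
  map_smul' _ _ := rfl

/-- The positive roots `ε_i - ε_j` and `ε_i + ε_j` for `i < j`, and `2ε_i`. The simple roots are
`ε_i - ε_{i+1}` for `i < n` and `2ε_n`. -/
inductive IsPositiveRoot {n : ℕ} : Wt n → Prop
  | sub (i j : Fin n) (h : i < j) : IsPositiveRoot (ε i - ε j)
  | add (i j : Fin n) (h : i < j) : IsPositiveRoot (ε i + ε j)
  | long (i : Fin n) : IsPositiveRoot ((2 : ℂ) • ε i)

/-- `X` lies in the root space of `α`, that is `[H, X] = α(H) X` for all `H` in the Cartan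
subalgebra. -/
def IsRootVector {n : ℕ} (α : Wt n) (X : 𝔤 n) : Prop :=
  ∀ H : 𝔥 n, ⁅(H : 𝔤 n), X⁆ = α H • X

/-- The `i`-th fundamental weight `ϖ_i = ε_1 + ⋯ + ε_i`, `1 ≤ i ≤ n`; here `i` is counted from `1`,
while the `j : Fin n` are counted from `0`. -/
def ϖ (n : ℕ) (i : ℕ) : Wt n := ∑ j : Fin n with j.val < i, ε j

/-- The universal enveloping algebra `U` of `sp(2n, ℂ)`. -/
abbrev U (n : ℕ) : Type := UniversalEnvelopingAlgebra ℂ (𝔤 n)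

/-- The canonical map `sp(2n, ℂ) → U`. -/
abbrev ιU (n : ℕ) (X : 𝔤 n) : U n := UniversalEnvelopingAlgebra.ι ℂ X

/-- The left ideal of `U` generated by the root vectors of the positive roots and by the elements
`H - lam(H)`, `H` in the Cartan subalgebra. -/
def vermaIdeal {n : ℕ} (lam : Wt n) : Submodule (U n) (U n) :=
  Submodule.span (U n)
    ({u | ∃ (α : Wt n) (X : 𝔤 n), IsPositiveRoot α ∧ IsRootVector α X ∧ u = ιU n X} ∪
      {u | ∃ H : 𝔥 n, u = ιU n (H : 𝔤 n) - algebraMap ℂ (U n) (lam H)})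

/-- The Verma module with highest weight `lam`. -/
abbrev Verma {n : ℕ} (lam : Wt n) : Type := U n ⧸ vermaIdeal lam

/-- The sum of all proper submodules of the Verma module with highest weight `lam`. (It is the
largest proper submodule.) -/
def vermaRadical {n : ℕ} (lam : Wt n) : Submodule (U n) (Verma lam) :=
  sSup {N | N ≠ ⊤}

/-- The irreducible highest weight module `L(lam)`: the quotient of the Verma module by its
largest proper submodule. -/
def L {n : ℕ} (lam : Wt n) : Type := Verma lam ⧸ vermaRadical lam

instance {n : ℕ} (lam : Wt n) : AddCommGroup (L lam) :=
  inferInstanceAs (AddCommGroup (Verma lam ⧸ vermaRadical lam))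

instance {n : ℕ} (lam : Wt n) : Module (U n) (L lam) :=
  inferInstanceAs (Module (U n) (Verma lam ⧸ vermaRadical lam))

instance {n : ℕ} (lam : Wt n) : Module ℂ (L lam) :=
  inferInstanceAs (Module ℂ (Verma lam ⧸ vermaRadical lam))

instance {n : ℕ} (lam : Wt n) : IsScalarTower ℂ (U n) (L lam) :=
  inferInstanceAs (IsScalarTower ℂ (U n) (Verma lam ⧸ vermaRadical lam))

/-- `sp(2n, ℂ)` acts on `L(lam)` through `U`. -/
instance {n : ℕ} (lam : Wt n) : LieRingModule (𝔤 n) (L lam) where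
  bracket X v := ιU n X • v
  add_lie X Y v := by
    change ιU n (X + Y) • v = ιU n X • v + ιU n Y • v
    rw [← add_smul]; simp [ιU]
  lie_add X v w := smul_add _ v w
  leibniz_lie X Y v := by
    change ιU n X • ιU n Y • v = ιU n ⁅X, Y⁆ • v + ιU n Y • ιU n X • v
    simp only [ιU, LieHom.map_lie, LieRing.of_associative_ring_bracket, sub_smul, mul_smul]
    abel

instance {n : ℕ} (lam : Wt n) : LieModule ℂ (𝔤 n) (L lam) where
  smul_lie c X v := by
    change ιU n (c • X) • v = c • ιU n X • v
    rw [← smul_assoc]; simp [ιU]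
  lie_smul c X v := by
    change ιU n X • c • v = c • ιU n X • v
    rw [← algebraMap_smul (U n) c v, ← mul_smul, ← Algebra.commutes, mul_smul, algebraMap_smul]

/-- The set of the weights `c₁ϖ₁ + ⋯ + cₙϖₙ` with `c₁, …, c_{n-1}` nonnegative integers,
`cₙ ∈ ℤ + 1/2` and `c_{n-1} + 2cₙ + 3 > 0` (for `n ≥ 2`). -/
def A (n : ℕ) : Set (Wt n) :=
  {lam | ∃ c : ℕ → ℝ, lam = ∑ i ∈ Finset.Icc 1 n, (c i : ℂ) • ϖ n i ∧
    (∀ i ∈ Finset.Icc 1 (n - 1), ∃ m : ℕ, c i = m) ∧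
    (∃ k : ℤ, c n = k + 1 / 2) ∧
    c (n - 1) + 2 * c n + 3 > 0}

/-- `A_μ`: the elements of `A` of the form `μ ± ε_i`. -/
def Aof {n : ℕ} (μ : Wt n) : Set (Wt n) :=
  A n ∩ {lam | ∃ i : Fin n, lam = μ + ε i ∨ lam = μ - ε i}

end SymplecticTensor

end

noncomputable section

namespace SymplecticTensor

/-! Write `ρ = (n, …, 1)` and `x = μ + ρ`. In these coordinates `μ ∈ A` says that all `x_i` are
half-odd, `x_1 > ⋯ > x_n` and `x_{n-1} + x_n > 0`: `x` is regular dominant for type `D`, not for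
type `C`. In particular the `2n` numbers `±x_i` are pairwise distinct.

A shifted split Casimir operator on `L(μ) ⊗ ℂ²ⁿ` commutes with `𝔤` and is triangular with respect to
the vectors `v ⊗ e_k`, where `v` is the highest weight vector; its diagonal entries are the `±x_i`
(`cas`). So the tensor product is the direct sum of `2n` eigenspaces, cut out by Lagrange
projections (`casProj_mem`, `sum_casProj`). The eigenspace of index `l` is generated by the
projection of `v ⊗ e_l`, a singular vector of weight `μ + wt l` (`casSpace_eq_lieSpan`). By the dual
argument it is cogenerated by the functional `φ ⊗ e_l^*`, where `φ` is the lowest-part-killing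
functional on `L(μ)`. Generation by one and cogeneration by the other leave two cases: the pairing
of the two (`leadCoeff`) is zero and the eigenspace vanishes, or it is nonzero and the eigenspace is
simple of highest weight `μ + wt l`.

The pairings satisfy a triangular linear system in the `x_i`, whose solution telescopes into
products (`partial_sum_ne_zero_iff`, `backward_sum_eq`). They vanish exactly when `μ + wt l` leaves
`A` (`leadCoeff_ne_zero_iff`). The walls of the long roots do not appear in the products, because
half-odd coordinates never meet them; this is where type `D` enters.

It remains to know that the modules `L(λ)`, `λ ∈ A`, are nonzero, that is, that the ideal defining
the Verma module is proper. Any nonzero singular vector of weight `λ` proves this. The oscillator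
representation provides one for a single weight of `A`, and the decomposition above carries it along
steps `±ε_i` to all of `A` (`IsDRegular.vermaIdeal_ne_top`). -/

/-! ### Matrix generators, weights and the height grading of `sp(2n)`. -/

/-- The height of a basis vector of `ℂ²ⁿ`: the eigenvalue of `diag(n, …, 1, -n, …, -1)`. -/
def height {n : ℕ} : Fin n ⊕ Fin n → ℤ :=
  Sum.elim (fun i => (n : ℤ) - i) (fun i => (i : ℤ) - n)

/-- The sign `+1` on the first half of the basis of `ℂ²ⁿ` and `-1` on the second half. -/
def sgn {n : ℕ} : Fin n ⊕ Fin n → ℂ := Sum.elim (fun _ => 1) (fun _ => -1)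

theorem sgn_mul_self {n : ℕ} (k : Fin n ⊕ Fin n) : sgn k * sgn k = 1 := by
  rcases k with k | k <;> simp [sgn]

theorem sgn_swap {n : ℕ} (k : Fin n ⊕ Fin n) : sgn k.swap = - sgn k := by
  rcases k with k | k <;> simp [sgn]

theorem height_swap {n : ℕ} (k : Fin n ⊕ Fin n) : height k.swap = - height k := by
  rcases k with k | k <;> simp [height]

theorem height_injective {n : ℕ} : Function.Injective (height (n := n)) := by
  rintro (i | i) (j | j) h <;> simp only [height, Sum.elim_inl, Sum.elim_inr] at h
  · congr 1; ext; omega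
  · omega
  · omega
  · congr 1; ext; omega

theorem J_apply {n : ℕ} (k l : Fin n ⊕ Fin n) :
    Matrix.J (Fin n) ℂ k l = if l = k.swap then - sgn k else 0 := by
  rcases k with k | k <;> rcases l with l | l <;>
    simp [Matrix.J, sgn, Matrix.one_apply, eq_comm]
  split_ifs <;> simp

theorem mem_sp_iff {n : ℕ} (X : Matrix (Fin n ⊕ Fin n) (Fin n ⊕ Fin n) ℂ) :
    X ∈ 𝔤 n ↔ ∀ k l, X l.swap k.swap = - (sgn k * sgn l) * X k l := by
  have hJ : ∀ l m : Fin n ⊕ Fin n, (l = m.swap) = (m = l.swap) := by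
    intro l m; apply propext; constructor <;> (rintro rfl; simp)
  have h1 : X ∈ 𝔤 n ↔ ∀ k l, sgn l * X l.swap k = sgn k * X k.swap l := by
    change X ∈ skewAdjointMatricesLieSubalgebra (Matrix.J (Fin n) ℂ) ↔ _
    rw [mem_skewAdjointMatricesLieSubalgebra,
      mem_skewAdjointMatricesSubmodule, Matrix.IsSkewAdjoint, Matrix.IsAdjointPair,
      ← Matrix.ext_iff]
    refine forall_congr' fun k => forall_congr' fun l => ?_
    rw [Matrix.mul_apply, Matrix.mul_apply]
    simp only [J_apply, hJ l, mul_ite, ite_mul, zero_mul, mul_zero,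
      Finset.sum_ite_eq', Finset.mem_univ, if_true, Matrix.transpose_apply, sgn_swap,
      Matrix.neg_apply]
    constructor <;> intro h <;> linear_combination h
  rw [h1]
  constructor
  · intro h k l
    have := h k.swap l
    simp only [sgn_swap, Sum.swap_swap] at this
    linear_combination sgn l * this - X l.swap k.swap * sgn_mul_self l
  · intro h k l
    have := h k.swap l
    simp only [sgn_swap, Sum.swap_swap] at this
    linear_combination sgn l * this + sgn k * X k.swap l * sgn_mul_self l

theorem sp_apply_swap {n : ℕ} (X : 𝔤 n) (k l : Fin n ⊕ Fin n) :
    (X : Matrix _ _ ℂ) l.swap k.swap = - (sgn k * sgn l) * (X : Matrix _ _ ℂ) k l :=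
  (mem_sp_iff _).1 X.2 k l

theorem swap_eq_iff {n : ℕ} (k l : Fin n ⊕ Fin n) : k.swap = l ↔ k = l.swap := by
  constructor <;> (rintro rfl; simp)

/-- The symplectic matrix `E_kj - σ_k σ_j E_{j̄k̄}`. -/
def elt {n : ℕ} (k j : Fin n ⊕ Fin n) : 𝔤 n :=
  ⟨Matrix.single k j 1 - (sgn k * sgn j) • Matrix.single j.swap k.swap 1, by
    rw [mem_sp_iff]
    intro a b
    simp only [Matrix.sub_apply, Matrix.smul_apply, Matrix.single_apply, smul_eq_mul,
      swap_eq_iff, Sum.swap_swap]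
    have e1 : (k = b.swap ∧ j = a.swap) ↔ (j = a.swap ∧ k = b.swap) := and_comm
    have e2 : (j = b ∧ k = a) ↔ (k = a ∧ j = b) := and_comm
    simp only [e1, e2]
    by_cases h1 : j = a.swap ∧ k = b.swap
    · obtain ⟨rfl, rfl⟩ := h1
      have ha := sgn_mul_self a
      have hb := sgn_mul_self b
      by_cases h2 : b.swap = a ∧ a.swap = b
      · simp only [h2, and_self, if_true]
        obtain ⟨rfl, -⟩ := h2
        simp only [sgn_swap] at *
        linear_combination -(1 + sgn b * sgn b) * hb
      · simp only [h2, sgn_swap, and_self, if_true, if_false]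
        linear_combination -(sgn b * sgn b) * ha - hb
    · by_cases h2 : k = a ∧ j = b
      · obtain ⟨rfl, rfl⟩ := h2
        simp only [h1, and_self, if_true, if_false]
        ring
      · simp only [h1, h2, if_false]; ring⟩

theorem elt_apply {n : ℕ} (k j a b : Fin n ⊕ Fin n) :
    (elt k j : Matrix _ _ ℂ) a b =
      (if a = k then if b = j then 1 else 0 else 0) -
      sgn k * sgn j * (if a = j.swap then if b = k.swap then 1 else 0 else 0) := by
  simp only [elt, Matrix.sub_apply, Matrix.smul_apply, Matrix.single_apply, smul_eq_mul,
    ← ite_and, eq_comm (a := a), eq_comm (a := b)]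

/-- The factor `1/2` appears because `elt k j` and `elt j.swap k.swap` are proportional, so every
generator is counted twice; when `j = k.swap` the generator is itself twice a matrix unit. -/
theorem eq_sum_elt {n : ℕ} (X : 𝔤 n) :
    X = ∑ k, ∑ j, ((1 / 2 : ℂ) * (X : Matrix _ _ ℂ) k j) • elt k j := by
  apply Subtype.ext
  ext a b
  simp only [AddSubmonoidClass.coe_finsetSum, SetLike.val_smul, Matrix.sum_apply,
    Matrix.smul_apply, smul_eq_mul, elt_apply]
  simp only [mul_sub, Finset.sum_sub_distrib, mul_ite, mul_one, mul_zero]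
  have h1 : ∀ k j : Fin n ⊕ Fin n, (a = j.swap) = (j = a.swap) := by
    intro l m; apply propext; constructor <;> (rintro rfl; simp)
  have h2 : ∀ k j : Fin n ⊕ Fin n, (b = k.swap) = (k = b.swap) := by
    intro l m; apply propext; constructor <;> (rintro rfl; simp)
  simp only [Finset.sum_ite_irrel, Finset.sum_const_zero, Finset.sum_ite_eq, Finset.mem_univ,
    if_true, h1 a, h2 _ a]
  simp only [Finset.sum_ite_eq', Finset.mem_univ, if_true]
  rw [sp_apply_swap X a b, sgn_swap, sgn_swap]
  linear_combination -(1 / 2) * (X : Matrix _ _ ℂ) a b *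
    (sgn b * sgn b * sgn_mul_self a + sgn_mul_self b)

/-- The map `E_kj ↦ elt k j` from all matrices onto `𝔤` is equivariant, so the bracket is that of
`X` with a matrix unit. The invariance of the Casimir operator rests on this. -/
theorem lie_elt {n : ℕ} (X : 𝔤 n) (k j : Fin n ⊕ Fin n) :
    ⁅X, elt k j⁆ = ∑ l, (X : Matrix _ _ ℂ) l k • elt l j -
      ∑ l, (X : Matrix _ _ ℂ) j l • elt k l := by
  apply Subtype.ext
  ext a b
  have h1 : ∀ k j : Fin n ⊕ Fin n, (j = k.swap) = (k = j.swap) := by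
    intro l m; apply propext; constructor <;> (rintro rfl; simp)
  simp only [LieSubalgebra.coe_bracket, Ring.lie_def, Matrix.sub_apply, Matrix.mul_apply,
    AddSubgroupClass.coe_sub,
    AddSubmonoidClass.coe_finsetSum, SetLike.val_smul, Matrix.sum_apply,
    Matrix.smul_apply, smul_eq_mul, elt_apply]
  simp only [mul_sub, sub_mul, Finset.sum_sub_distrib, mul_ite, mul_one, mul_zero, ite_mul,
    zero_mul, one_mul]
  simp only [h1 _ a, h1 _ b]
  simp only [Finset.sum_ite_irrel, Finset.sum_const_zero, Finset.sum_ite_eq, Finset.sum_ite_eq',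
    Finset.mem_univ, if_true, sgn_swap]
  have e1 := sp_apply_swap X b.swap k
  have e2 := sp_apply_swap X j a.swap
  simp only [Sum.swap_swap, sgn_swap] at e1 e2
  have e3 := sgn_mul_self k
  have e4 := sgn_mul_self j
  have e5 : sgn k * sgn j * (X : Matrix _ _ ℂ) k.swap b =
      sgn b * sgn j * (X : Matrix _ _ ℂ) b.swap k := by
    rw [e1]; linear_combination sgn b * sgn j * (X : Matrix _ _ ℂ) b.swap k * e3
  have e6 : (X : Matrix _ _ ℂ) a j.swap * (sgn k * sgn j) =
      sgn k * sgn a * (X : Matrix _ _ ℂ) j a.swap := by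
    rw [e2]; linear_combination sgn k * sgn a * (X : Matrix _ _ ℂ) j a.swap * e4
  simp only [e5, e6]
  split_ifs <;> ring1

/-- The weight of a basis vector of `ℂ²ⁿ`. -/
def wt {n : ℕ} : Fin n ⊕ Fin n → Wt n := Sum.elim (fun i => ε i) (fun i => - ε i)

theorem wt_apply {n : ℕ} (k : Fin n ⊕ Fin n) (H : 𝔥 n) :
    wt k H = ((H : 𝔤 n) : Matrix _ _ ℂ) k k := by
  rcases k with k | k
  · rfl
  · have := sp_apply_swap (H : 𝔤 n) (Sum.inl k) (Sum.inl k)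
    simp only [sgn, Sum.swap_inl, Sum.elim_inl] at this
    change -((H : 𝔤 n) : Matrix (Fin n ⊕ Fin n) (Fin n ⊕ Fin n) ℂ) (Sum.inl k) (Sum.inl k) = _
    rw [this]; ring

theorem lie_cartan_elt {n : ℕ} (H : 𝔥 n) (k j : Fin n ⊕ Fin n) :
    ⁅(H : 𝔤 n), elt k j⁆ = (wt k H - wt j H) • elt k j := by
  have hd : ((H : 𝔤 n) : Matrix (Fin n ⊕ Fin n) (Fin n ⊕ Fin n) ℂ).IsDiag := H.2
  rw [lie_elt, Finset.sum_eq_single k, Finset.sum_eq_single j, ← wt_apply, ← wt_apply, sub_smul]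
  · intro b _ hb; rw [hd hb.symm, zero_smul]
  · simp
  · intro b _ hb; rw [hd hb, zero_smul]
  · simp

/-- The matrix unit `E_kk - E_{k̄k̄}` as an element of the Cartan subalgebra. -/
def cartanElt {n : ℕ} (k : Fin n ⊕ Fin n) : 𝔥 n :=
  ⟨elt k k, by
    intro a b hab
    rw [elt_apply]
    split_ifs <;> simp_all⟩

theorem coe_cartanElt {n : ℕ} (k : Fin n ⊕ Fin n) : (cartanElt k : 𝔤 n) = elt k k := rfl

theorem wt_cartanElt {n : ℕ} (k j : Fin n ⊕ Fin n) :
    wt j (cartanElt k) = (if j = k then 1 else 0) - (if j = k.swap then 1 else 0) := by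
  rw [wt_apply, coe_cartanElt, elt_apply, sgn_mul_self]
  split_ifs <;> simp

theorem cartan_eq_sum {n : ℕ} (H : 𝔥 n) : H = ∑ k, ((1 / 2 : ℂ) * wt k H) • cartanElt k := by
  have hd : ((H : 𝔤 n) : Matrix (Fin n ⊕ Fin n) (Fin n ⊕ Fin n) ℂ).IsDiag := H.2
  apply Subtype.ext
  conv_lhs => rw [eq_sum_elt (H : 𝔤 n)]
  rw [AddSubmonoidClass.coe_finsetSum]
  refine Finset.sum_congr rfl fun k _ => ?_
  rw [Finset.sum_eq_single k]
  · rw [← wt_apply, SetLike.val_smul, coe_cartanElt]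
  · intro b _ hb; rw [hd hb.symm]; simp
  · simp

/-- The element `diag(n, …, 1, -n, …, -1)` of the Cartan subalgebra. -/
def gradingElt (n : ℕ) : 𝔥 n := ∑ k, ((1 / 2 : ℂ) * height k) • cartanElt k

theorem wt_gradingElt {n : ℕ} (k : Fin n ⊕ Fin n) : wt k (gradingElt n) = height k := by
  simp only [gradingElt, map_sum, map_smul, wt_cartanElt, smul_eq_mul, mul_sub, mul_ite, mul_one,
    mul_zero, Finset.sum_sub_distrib, Finset.sum_ite_eq, Finset.mem_univ, if_true]
  have h1 : ∀ j : Fin n ⊕ Fin n, (k = j.swap) = (j = k.swap) := by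
    intro j; apply propext; constructor <;> (rintro rfl; simp)
  simp only [h1, Finset.sum_ite_eq', Finset.mem_univ, if_true, height_swap]
  push_cast; ring

theorem wt_sub_wt_isPositiveRoot {n : ℕ} {k j : Fin n ⊕ Fin n} (h : height j < height k) :
    IsPositiveRoot (wt k - wt j) := by
  rcases k with k | k <;> rcases j with j | j <;>
    simp only [height, wt, Sum.elim_inl, Sum.elim_inr] at h ⊢
  · exact .sub k j (Fin.lt_def.2 (by omega))
  · rcases lt_trichotomy k j with hkj | rfl | hkj
    · simpa using IsPositiveRoot.add k j hkj
    · simpa [two_smul] using IsPositiveRoot.long k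
    · simpa [add_comm] using IsPositiveRoot.add j k hkj
  · omega
  · have := IsPositiveRoot.sub j k (Fin.lt_def.2 (by omega))
    rwa [show ε j - ε k = -ε k - -ε j by abel] at this

theorem isRootVector_elt {n : ℕ} (k j : Fin n ⊕ Fin n) :
    IsRootVector (wt k - wt j) (elt k j) := fun H => by
  rw [lie_cartan_elt]; rfl

/-- The grading element separates positive from negative roots, so a single operator can replace the
whole weight decomposition in what follows. -/
theorem IsPositiveRoot.exists_pos {n : ℕ} {α : Wt n} (hα : IsPositiveRoot α) :
    ∃ m : ℤ, 0 < m ∧ α (gradingElt n) = m := by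
  have e : ∀ i : Fin n, ε i (gradingElt n) = ((n - i : ℤ) : ℂ) := fun i => by
    have := wt_gradingElt (Sum.inl i)
    simpa [wt, height] using this
  rcases hα with ⟨i, j, h⟩ | ⟨i, j, h⟩ | ⟨i⟩
  · refine ⟨j - i, by have := Fin.lt_def.1 h; omega, ?_⟩
    rw [LinearMap.sub_apply, e, e]; push_cast; ring
  · refine ⟨(n - i) + (n - j), by omega, ?_⟩
    rw [LinearMap.add_apply, e, e]; push_cast; ring
  · refine ⟨2 * (n - i), by omega, ?_⟩
    rw [LinearMap.smul_apply, e]; push_cast; simp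

/-- A root vector of a positive root is supported on the entries `(k, j)` with `e_k` above `e_j`. -/
theorem IsRootVector.apply_eq_zero {n : ℕ} {α : Wt n} {X : 𝔤 n} (hX : IsRootVector α X)
    (hα : IsPositiveRoot α) {k j : Fin n ⊕ Fin n} (h : height k ≤ height j) :
    (X : Matrix _ _ ℂ) k j = 0 := by
  obtain ⟨m, hm, hm'⟩ := hα.exists_pos
  have h1 := congrArg (fun Y : 𝔤 n => (Y : Matrix _ _ ℂ) k j) (hX (gradingElt n))
  have hd : ((gradingElt n : 𝔤 n) : Matrix (Fin n ⊕ Fin n) (Fin n ⊕ Fin n) ℂ).IsDiag :=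
    (gradingElt n).2
  simp only [LieSubalgebra.coe_bracket, Ring.lie_def, Matrix.sub_apply, Matrix.mul_apply,
    SetLike.val_smul, Matrix.smul_apply, smul_eq_mul] at h1
  rw [Finset.sum_eq_single k, Finset.sum_eq_single j, ← wt_apply, ← wt_apply, wt_gradingElt,
    wt_gradingElt, hm'] at h1
  · have h2 : ((height k - height j - m : ℤ) : ℂ) * (X : Matrix _ _ ℂ) k j = 0 := by
      push_cast; linear_combination h1
    rcases mul_eq_zero.1 h2 with h3 | h3
    · have : height k - height j - m = 0 := by exact_mod_cast h3
      omega
    · exact h3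
  · intro b _ hb; rw [hd hb, mul_zero]
  · simp
  · intro b _ hb; rw [hd hb.symm, zero_mul]
  · simp

/-! ### Modules generated by a singular vector and their cosingular functionals. -/

section HighestWeight

variable {n : ℕ} {M : Type*} [AddCommGroup M] [Module ℂ M] [LieRingModule (𝔤 n) M]
  [LieModule ℂ (𝔤 n) M]

/-- `v` is killed by the raising operators and has weight `μ`. -/
structure IsSingular (μ : Wt n) (v : M) : Prop where
  raise : ∀ k j, height j < height k → ⁅(elt k j : 𝔤 n), v⁆ = 0
  weight : ∀ H : 𝔥 n, ⁅(H : 𝔤 n), v⁆ = μ H • v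

/-- The functional `φ` kills the image of the lowering operators and has weight `μ`. -/
structure IsCosingular (μ : Wt n) (φ : M →ₗ[ℂ] ℂ) : Prop where
  lower : ∀ k j, height k < height j → ∀ m, φ ⁅(elt k j : 𝔤 n), m⁆ = 0
  weight : ∀ (H : 𝔥 n) (m : M), φ ⁅(H : 𝔤 n), m⁆ = μ H * φ m

/-- `M` is generated by the singular vector `v` and cogenerated by the cosingular functional `φ`,
both of weight `μ`, and `φ v ≠ 0`. -/
structure IsSimpleHighestWeight (μ : Wt n) (v : M) (φ : M →ₗ[ℂ] ℂ) : Prop where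
  singular : IsSingular μ v
  cosingular : IsCosingular μ φ
  gen : LieSubmodule.lieSpan ℂ (𝔤 n) {v} = ⊤
  cogen : ∀ N : LieSubmodule ℂ (𝔤 n) M, (∀ m ∈ N, φ m = 0) → N = ⊥
  ne_zero : φ v ≠ 0

theorem lie_eq_sum_elt (X : 𝔤 n) (m : M) :
    ⁅X, m⁆ = ∑ k, ∑ j, ((1 / 2 : ℂ) * (X : Matrix _ _ ℂ) k j) • ⁅(elt k j : 𝔤 n), m⁆ := by
  conv_lhs => rw [eq_sum_elt X]
  simp only [_root_.sum_lie, smul_lie]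

/-- A subspace containing a generating singular vector and stable under lowering operators is
everything. -/
theorem IsSingular.eq_top_of_lower {μ : Wt n} {v : M} (hv : IsSingular μ v)
    (hgen : LieSubmodule.lieSpan ℂ (𝔤 n) {v} = ⊤) (S : Submodule ℂ M) (hvS : v ∈ S)
    (hS : ∀ k j, height k < height j → ∀ s ∈ S, ⁅(elt k j : 𝔤 n), s⁆ ∈ S) : S = ⊤ := by
  -- Minimality replaces an ordering argument of PBW type. For the smallest member `T` of `C`, the
  -- vectors of `T` that all of `𝔤` sends into `T` again form a member of `C`; hence `T` is a Lie
  -- submodule containing the generator.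
  set C : Set (Submodule ℂ M) :=
    {S | v ∈ S ∧ ∀ k j, height k < height j → ∀ s ∈ S, ⁅(elt k j : 𝔤 n), s⁆ ∈ S}
  set T : Submodule ℂ M := sInf C
  have hvT : v ∈ T := (Submodule.mem_sInf).2 fun S hS => hS.1
  have hT : ∀ k j, height k < height j → ∀ s ∈ T, ⁅(elt k j : 𝔤 n), s⁆ ∈ T := by
    intro k j h s hs
    exact (Submodule.mem_sInf).2 fun S hS => hS.2 k j h s ((Submodule.mem_sInf).1 hs S hS)
  let T' : Submodule ℂ M :=
    { carrier := {s | s ∈ T ∧ ∀ X : 𝔤 n, ⁅X, s⁆ ∈ T}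
      add_mem' := fun ha hb => ⟨T.add_mem ha.1 hb.1, fun X => by
        rw [lie_add]; exact T.add_mem (ha.2 X) (hb.2 X)⟩
      zero_mem' := ⟨T.zero_mem, fun X => by rw [lie_zero]; exact T.zero_mem⟩
      smul_mem' := fun c a ha => ⟨T.smul_mem c ha.1, fun X => by
        rw [lie_smul]; exact T.smul_mem c (ha.2 X)⟩ }
  have hT' : T' ∈ C := by
    refine ⟨⟨hvT, fun X => ?_⟩, fun k j h s hs => ⟨hT k j h s hs.1, fun X => ?_⟩⟩
    · rw [lie_eq_sum_elt]
      refine T.sum_mem fun k _ => T.sum_mem fun j _ => T.smul_mem _ ?_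
      rcases lt_trichotomy (height k) (height j) with h | h | h
      · exact hT k j h v hvT
      · obtain rfl := height_injective h
        rw [← coe_cartanElt, hv.weight]
        exact T.smul_mem _ hvT
      · rw [hv.raise k j h]; exact T.zero_mem
    · rw [leibniz_lie]
      exact T.add_mem (hs.2 _) (hT k j h _ (hs.2 X))
  have hle : T ≤ T' := sInf_le hT'
  let N : LieSubmodule ℂ (𝔤 n) M := { T with lie_mem := fun {X m} hm => (hle hm).2 X }
  have hN : N = ⊤ := by
    rw [← top_le_iff, ← hgen, LieSubmodule.lieSpan_le, Set.singleton_subset_iff]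
    exact hvT
  have hTS : T ≤ S := sInf_le ⟨hvS, hS⟩
  rw [← top_le_iff]
  refine le_trans ?_ hTS
  intro m _
  have : m ∈ N := hN ▸ LieSubmodule.mem_top m
  exact this

variable (n M) in
/-- The span of the images of the lowering operators. -/
def lowerSpan : Submodule ℂ M :=
  Submodule.span ℂ {m | ∃ k j, ∃ m' : M, height k < height j ∧ m = ⁅(elt k j : 𝔤 n), m'⁆}

omit [LieModule ℂ (𝔤 n) M] in
theorem IsCosingular.eq_zero_of_mem_lowerSpan {μ : Wt n} {φ : M →ₗ[ℂ] ℂ} (hφ : IsCosingular μ φ)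
    {m : M} (hm : m ∈ lowerSpan n M) : φ m = 0 := by
  have : lowerSpan n M ≤ LinearMap.ker φ := by
    rw [lowerSpan, Submodule.span_le]
    rintro _ ⟨k, j, m', h, rfl⟩
    exact hφ.lower k j h m'
  exact this hm

theorem IsSingular.exists_eq {μ : Wt n} {v : M} (hv : IsSingular μ v)
    (hgen : LieSubmodule.lieSpan ℂ (𝔤 n) {v} = ⊤) (m : M) :
    ∃ a : ℂ, ∃ m' ∈ lowerSpan n M, m = a • v + m' := by
  have : Submodule.span ℂ {v} ⊔ lowerSpan n M = ⊤ := by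
    apply hv.eq_top_of_lower hgen
    · exact Submodule.mem_sup_left (Submodule.mem_span_singleton_self v)
    · intro k j h s _
      exact Submodule.mem_sup_right (Submodule.subset_span ⟨k, j, s, h, rfl⟩)
  have hm : m ∈ Submodule.span ℂ {v} ⊔ lowerSpan n M := this ▸ Submodule.mem_top
  obtain ⟨y, hy, z, hz, rfl⟩ := Submodule.mem_sup.1 hm
  obtain ⟨a, rfl⟩ := Submodule.mem_span_singleton.1 hy
  exact ⟨a, z, hz, rfl⟩

variable (n M) in
/-- The action of the grading element. -/
def gradingEnd : Module.End ℂ M := LieModule.toEnd ℂ (𝔤 n) M (gradingElt n)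

theorem gradingEnd_apply (m : M) : gradingEnd n M m = ⁅(gradingElt n : 𝔤 n), m⁆ := rfl

theorem lie_elt_mem_eigenspace {c : ℂ} {m : M} (hm : m ∈ (gradingEnd n M).eigenspace c)
    (k j : Fin n ⊕ Fin n) :
    ⁅(elt k j : 𝔤 n), m⁆ ∈ (gradingEnd n M).eigenspace (c + (height k - height j : ℤ)) := by
  rw [Module.End.mem_eigenspace_iff, gradingEnd_apply] at hm ⊢
  rw [leibniz_lie, hm, lie_cartan_elt, wt_gradingElt, wt_gradingElt, smul_lie, lie_smul,
    ← add_smul]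
  push_cast; congr 1; ring

/-- Lowering operators strictly decrease the grading, and the whole module is graded in degrees at
most that of the generator. -/
theorem IsSingular.lowerSpan_le {μ : Wt n} {v : M} (hv : IsSingular μ v)
    (hgen : LieSubmodule.lieSpan ℂ (𝔤 n) {v} = ⊤) :
    lowerSpan n M ≤ ⨆ d : ℕ, (gradingEnd n M).eigenspace (μ (gradingElt n) - (d + 1 : ℕ)) := by
  have hall : (⨆ d : ℕ, (gradingEnd n M).eigenspace (μ (gradingElt n) - d)) = ⊤ := by
    apply hv.eq_top_of_lower hgen
    · refine Submodule.mem_iSup_of_mem 0 ?_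
      rw [Module.End.mem_eigenspace_iff, gradingEnd_apply, hv.weight]; simp
    · intro k j h s hs
      refine Submodule.iSup_induction _ (motive := fun s => ⁅(elt k j : 𝔤 n), s⁆ ∈ _) hs ?_ ?_ ?_
      · intro d m hm
        obtain ⟨e, he⟩ := Int.eq_ofNat_of_zero_le (a := height j - height k) (by omega)
        refine Submodule.mem_iSup_of_mem (d + e) ?_
        have := lie_elt_mem_eigenspace hm k j
        convert this using 2
        rw [show height k - height j = -(e : ℤ) by omega]; push_cast; ring
      · simp
      · intro x y hx hy; rw [lie_add]; exact Submodule.add_mem _ hx hy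
  rw [lowerSpan, Submodule.span_le]
  rintro _ ⟨k, j, s, h, rfl⟩
  have hs : s ∈ (⨆ d : ℕ, (gradingEnd n M).eigenspace (μ (gradingElt n) - d)) :=
    hall ▸ Submodule.mem_top
  refine Submodule.iSup_induction _ (motive := fun s => ⁅(elt k j : 𝔤 n), s⁆ ∈ _) hs ?_ ?_ ?_
  · intro d m hm
    obtain ⟨e, he⟩ := Int.eq_ofNat_of_zero_le (a := height j - height k - 1) (by omega)
    refine Submodule.mem_iSup_of_mem (d + e) ?_
    have := lie_elt_mem_eigenspace hm k j
    convert this using 2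
    rw [show height k - height j = -(e + 1 : ℤ) by omega]; push_cast; ring
  · simp
  · intro x y hx hy; rw [lie_add]; exact Submodule.add_mem _ hx hy

theorem IsSingular.notMem_lowerSpan {μ : Wt n} {v : M} (hv : IsSingular μ v)
    (hgen : LieSubmodule.lieSpan ℂ (𝔤 n) {v} = ⊤) (hv0 : v ≠ 0) : v ∉ lowerSpan n M := by
  intro h
  have h1 := hv.lowerSpan_le hgen h
  have h2 : v ∈ (gradingEnd n M).eigenspace (μ (gradingElt n)) := by
    rw [Module.End.mem_eigenspace_iff, gradingEnd_apply, hv.weight]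
  have h3 := (gradingEnd n M).eigenspaces_iSupIndep (μ (gradingElt n))
  refine hv0 ((Submodule.disjoint_def.1 h3) v h2 ?_)
  refine (iSup_le fun d => ?_ : (⨆ d : ℕ, (gradingEnd n M).eigenspace
    (μ (gradingElt n) - (d + 1 : ℕ))) ≤ _) h1
  refine le_iSup₂_of_le (μ (gradingElt n) - (d + 1 : ℕ)) ?_ le_rfl
  intro he
  have : ((d + 1 : ℕ) : ℂ) = 0 := by linear_combination -he
  exact absurd this (by exact_mod_cast Nat.succ_ne_zero d)

/-- The generator is not in the span of the images of lowering operators, so some functional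
separates the two. Its weight is forced because that span, which is stable under the Cartan
subalgebra, and the generator together fill the module. -/
theorem IsSingular.exists_cosingular {μ : Wt n} {v : M} (hv : IsSingular μ v)
    (hgen : LieSubmodule.lieSpan ℂ (𝔤 n) {v} = ⊤) (hv0 : v ≠ 0) :
    ∃ φ : M →ₗ[ℂ] ℂ, IsCosingular μ φ ∧ φ v ≠ 0 := by
  obtain ⟨φ, hφv, hφ⟩ := Submodule.exists_le_ker_of_notMem (hv.notMem_lowerSpan hgen hv0)
  have hlow : ∀ k j, height k < height j → ∀ m, φ ⁅(elt k j : 𝔤 n), m⁆ = 0 :=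
    fun k j h m => hφ (Submodule.subset_span ⟨k, j, m, h, rfl⟩)
  refine ⟨φ, ⟨hlow, fun H m => ?_⟩, hφv⟩
  obtain ⟨a, m', hm', rfl⟩ := hv.exists_eq hgen m
  have h0 : ∀ m ∈ lowerSpan n M, φ ⁅(H : 𝔤 n), m⁆ = 0 := by
    intro m hm
    refine Submodule.span_induction ?_ ?_ ?_ ?_ hm
    · rintro _ ⟨k, j, m, h, rfl⟩
      rw [leibniz_lie, lie_cartan_elt, smul_lie, map_add, map_smul, hlow k j h, hlow k j h]
      simp
    · simp
    · intro x y _ _ hx hy; rw [lie_add, map_add, hx, hy, add_zero]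
    · intro c x _ hx; rw [lie_smul, map_smul, hx, smul_zero]
  have h1 : φ m' = 0 := hφ hm'
  rw [lie_add, map_add, map_add, h0 m' hm', h1, lie_smul, hv.weight]
  simp; ring

/-- Write `m = a • v + m'` with `m'` in strictly lower degrees. A polynomial in the grading element
kills `m'` and multiplies `v` by a nonzero scalar, so it extracts `v` from `m` inside `N`. -/
theorem IsSingular.mem_of_ne_zero {μ : Wt n} {v : M} (hv : IsSingular μ v)
    (hgen : LieSubmodule.lieSpan ℂ (𝔤 n) {v} = ⊤) {φ : M →ₗ[ℂ] ℂ} (hφ : IsCosingular μ φ)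
    (N : LieSubmodule ℂ (𝔤 n) M) {m : M} (hm : m ∈ N) (hφm : φ m ≠ 0) : v ∈ N := by
  obtain ⟨a, m', hm', rfl⟩ := hv.exists_eq hgen m
  have ha : a ≠ 0 := by
    rintro rfl
    rw [zero_smul, zero_add, hφ.eq_zero_of_mem_lowerSpan hm'] at hφm
    exact hφm rfl
  obtain ⟨p, hp, hpc⟩ : ∃ p : Polynomial ℂ, Polynomial.aeval (gradingEnd n M) p m' = 0 ∧
      p.eval (μ (gradingElt n)) ≠ 0 := by
    refine Submodule.iSup_induction _ (motive := fun m => ∃ p : Polynomial ℂ,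
      Polynomial.aeval (gradingEnd n M) p m = 0 ∧ p.eval (μ (gradingElt n)) ≠ 0)
      (hv.lowerSpan_le hgen hm') ?_ ?_ ?_
    · intro d x hx
      refine ⟨Polynomial.X - Polynomial.C (μ (gradingElt n) - (d + 1 : ℕ)), ?_, ?_⟩
      · rw [Module.End.mem_eigenspace_iff] at hx
        simp only [map_sub, Polynomial.aeval_X, Polynomial.aeval_C, LinearMap.sub_apply, hx,
          Module.algebraMap_end_apply]
        rw [← sub_smul, sub_self]
      · simp only [Polynomial.eval_sub, Polynomial.eval_X, Polynomial.eval_C, sub_sub_cancel]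
        exact_mod_cast Nat.succ_ne_zero d
    · exact ⟨1, by simp, by simp⟩
    · rintro x y ⟨p, hp, hpc⟩ ⟨q, hq, hqc⟩
      refine ⟨p * q, ?_, by rw [Polynomial.eval_mul]; exact mul_ne_zero hpc hqc⟩
      rw [map_add]
      nth_rewrite 1 [mul_comm p q]
      rw [map_mul, map_mul, Module.End.mul_apply, Module.End.mul_apply, hp, hq]
      simp
  have hN : ∀ (q : Polynomial ℂ) (x : M), x ∈ N → Polynomial.aeval (gradingEnd n M) q x ∈ N := by
    intro q
    induction q using Polynomial.induction_on' with
    | add p q hp hq =>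
      intro x hx
      rw [map_add, LinearMap.add_apply]
      exact N.add_mem (hp x hx) (hq x hx)
    | monomial d c =>
      intro x hx
      rw [Polynomial.aeval_monomial, Module.End.mul_apply, Module.algebraMap_end_apply]
      refine N.smul_mem _ ?_
      induction d with
      | zero => simpa using hx
      | succ d ih =>
        rw [pow_succ', Module.End.mul_apply, gradingEnd_apply]
        exact N.lie_mem ih
  have h1 := hN p _ hm
  have h2 : gradingEnd n M v = μ (gradingElt n) • v := by rw [gradingEnd_apply, hv.weight]
  have h3 : Polynomial.aeval (gradingEnd n M) p v = p.eval (μ (gradingElt n)) • v :=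
    Module.End.aeval_apply_of_mem_apply_eq_smul h2
  rw [map_add, hp, add_zero, map_smul, h3, smul_smul] at h1
  have h4 := N.smul_mem (a * p.eval (μ (gradingElt n)))⁻¹ h1
  rwa [smul_smul, inv_mul_cancel₀ (mul_ne_zero ha hpc), one_smul] at h4

theorem IsSingular.eq_top_of_ne_zero {μ : Wt n} {v : M} (hv : IsSingular μ v)
    (hgen : LieSubmodule.lieSpan ℂ (𝔤 n) {v} = ⊤) {φ : M →ₗ[ℂ] ℂ} (hφ : IsCosingular μ φ)
    (N : LieSubmodule ℂ (𝔤 n) M) {m : M} (hm : m ∈ N) (hφm : φ m ≠ 0) : N = ⊤ := by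
  rw [← top_le_iff, ← hgen, LieSubmodule.lieSpan_le, Set.singleton_subset_iff]
  exact hv.mem_of_ne_zero hgen hφ N hm hφm

theorem IsSimpleHighestWeight.isIrreducible {μ : Wt n} {v : M} {φ : M →ₗ[ℂ] ℂ}
    (h : IsSimpleHighestWeight μ v φ) : LieModule.IsIrreducible ℂ (𝔤 n) M := by
  have : Nontrivial (LieSubmodule ℂ (𝔤 n) M) := by
    refine ⟨⊥, ⊤, fun hbt => h.ne_zero ?_⟩
    have : v ∈ (⊥ : LieSubmodule ℂ (𝔤 n) M) := hbt ▸ LieSubmodule.mem_top v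
    rw [(LieSubmodule.mem_bot v).1 this, map_zero]
  refine { eq_bot_or_eq_top := fun N => ?_ }
  by_cases hN : ∀ m ∈ N, φ m = 0
  · exact Or.inl (h.cogen N hN)
  · push Not at hN
    obtain ⟨m, hm, hφm⟩ := hN
    exact Or.inr (h.singular.eq_top_of_ne_zero h.gen h.cosingular N hm hφm)

end HighestWeight

/-! ### Verma modules and their simple quotients. -/

/-- By the universal property, the map `U n → S` lifting `ιU`, followed by the inclusion, is the
identity. -/
theorem U_mem_of_subalgebra {n : ℕ} (S : Subalgebra ℂ (U n)) (h : ∀ X : 𝔤 n, ιU n X ∈ S) (u : U n) :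
    u ∈ S := by
  let f : 𝔤 n →ₗ⁅ℂ⁆ S :=
    { toFun := fun X => ⟨ιU n X, h X⟩
      map_add' := fun X Y => Subtype.ext (map_add (UniversalEnvelopingAlgebra.ι ℂ) X Y)
      map_smul' := fun c X => Subtype.ext (map_smul (UniversalEnvelopingAlgebra.ι ℂ) c X)
      map_lie' := fun {X Y} => Subtype.ext (LieHom.map_lie (UniversalEnvelopingAlgebra.ι ℂ) X Y) }
  have h1 : S.val.comp (UniversalEnvelopingAlgebra.lift ℂ f) = AlgHom.id ℂ (U n) := by
    apply UniversalEnvelopingAlgebra.hom_ext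
    ext X
    simp [f]
  have h2 := congrArg (fun g : U n →ₐ[ℂ] U n => g u) h1
  simp only [AlgHom.comp_apply, AlgHom.id_apply] at h2
  rw [← h2]
  exact ((UniversalEnvelopingAlgebra.lift ℂ f) u).2

theorem U_smul_mem {n : ℕ} {V : Type*} [AddCommGroup V] [Module ℂ V] [Module (U n) V]
    [IsScalarTower ℂ (U n) V] (N : Submodule ℂ V) (h : ∀ (X : 𝔤 n), ∀ m ∈ N, ιU n X • m ∈ N)
    (u : U n) {m : V} (hm : m ∈ N) : u • m ∈ N := by
  let S : Subalgebra ℂ (U n) :=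
    { carrier := {u | ∀ m ∈ N, u • m ∈ N}
      add_mem' := fun ha hb m hm => by rw [add_smul]; exact N.add_mem (ha m hm) (hb m hm)
      mul_mem' := fun ha hb m hm => by rw [mul_smul]; exact ha _ (hb m hm)
      algebraMap_mem' := fun c m hm => by rw [algebraMap_smul]; exact N.smul_mem c hm }
  exact U_mem_of_subalgebra S h u m hm

instance {n : ℕ} (lam : Wt n) : LieRingModule (𝔤 n) (Verma lam) where
  bracket X v := ιU n X • v
  add_lie X Y v := by
    change ιU n (X + Y) • v = ιU n X • v + ιU n Y • v
    rw [← add_smul]; simp [ιU]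
  lie_add X v w := smul_add _ v w
  leibniz_lie X Y v := by
    change ιU n X • ιU n Y • v = ιU n ⁅X, Y⁆ • v + ιU n Y • ιU n X • v
    simp only [ιU, LieHom.map_lie, LieRing.of_associative_ring_bracket, sub_smul, mul_smul]
    abel

instance {n : ℕ} (lam : Wt n) : LieModule ℂ (𝔤 n) (Verma lam) where
  smul_lie c X v := by
    change ιU n (c • X) • v = c • ιU n X • v
    rw [← smul_assoc]; simp [ιU]
  lie_smul c X v := by
    change ιU n X • c • v = c • ιU n X • v
    rw [← algebraMap_smul (U n) c v, ← mul_smul, ← Algebra.commutes, mul_smul, algebraMap_smul]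

theorem verma_lie_def {n : ℕ} {lam : Wt n} (X : 𝔤 n) (v : Verma lam) : ⁅X, v⁆ = ιU n X • v := rfl

/-- The canonical generator of the Verma module. -/
def vermaGen {n : ℕ} (lam : Wt n) : Verma lam := Submodule.Quotient.mk 1

theorem smul_vermaGen {n : ℕ} {lam : Wt n} (u : U n) :
    u • vermaGen lam = Submodule.Quotient.mk u := by
  rw [vermaGen, ← Submodule.Quotient.mk_smul, smul_eq_mul, mul_one]

theorem isSingular_vermaGen {n : ℕ} (lam : Wt n) : IsSingular lam (vermaGen lam) where
  raise k j h := by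
    rw [verma_lie_def, smul_vermaGen, Submodule.Quotient.mk_eq_zero]
    exact Submodule.subset_span (Or.inl ⟨_, _, wt_sub_wt_isPositiveRoot h, isRootVector_elt k j, rfl⟩)
  weight H := by
    rw [verma_lie_def, ← algebraMap_smul (U n) (lam H) (vermaGen lam), smul_vermaGen,
      smul_vermaGen, Submodule.Quotient.eq]
    exact Submodule.subset_span (Or.inr ⟨H, rfl⟩)

theorem lieSpan_vermaGen {n : ℕ} (lam : Wt n) :
    LieSubmodule.lieSpan ℂ (𝔤 n) {vermaGen lam} = ⊤ := by
  rw [← top_le_iff]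
  intro m _
  obtain ⟨u, rfl⟩ := Submodule.Quotient.mk_surjective _ m
  rw [← smul_vermaGen]
  refine U_smul_mem (LieSubmodule.lieSpan ℂ (𝔤 n) {vermaGen lam}).toSubmodule
    (fun X m hm => LieSubmodule.lie_mem _ hm) u ?_
  exact LieSubmodule.subset_lieSpan rfl

/-- The annihilator of `v` in `U` is a left ideal containing the defining generators of `vermaIdeal
μ`, but not `1`. This is the substitute for the PBW theorem. -/
theorem vermaIdeal_ne_top {n : ℕ} {M : Type*} [AddCommGroup M] [Module ℂ M]
    [LieRingModule (𝔤 n) M] [LieModule ℂ (𝔤 n) M] {μ : Wt n} {v : M} (hv : IsSingular μ v)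
    (hv0 : v ≠ 0) : vermaIdeal μ ≠ ⊤ := by
  set f := UniversalEnvelopingAlgebra.lift ℂ (LieModule.toEnd ℂ (𝔤 n) M)
  have hf : ∀ (X : 𝔤 n) (m : M), f (ιU n X) m = ⁅X, m⁆ := fun X m => by
    simp only [f, UniversalEnvelopingAlgebra.lift_ι_apply]; rfl
  let I : Submodule (U n) (U n) :=
    { carrier := {u | f u v = 0}
      add_mem' := fun {a b} ha hb => by
        simp only [Set.mem_ofPred_eq, map_add, LinearMap.add_apply] at *; rw [ha, hb, add_zero]
      zero_mem' := by simp
      smul_mem' := fun c a ha => by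
        simp only [Set.mem_ofPred_eq, smul_eq_mul, map_mul, Module.End.mul_apply] at *
        rw [ha, map_zero] }
  have hI : vermaIdeal μ ≤ I := by
    rw [vermaIdeal, Submodule.span_le]
    rintro _ (⟨α, X, hα, hX, rfl⟩ | ⟨H, rfl⟩)
    · change f _ v = 0
      rw [hf, lie_eq_sum_elt]
      refine Finset.sum_eq_zero fun k _ => Finset.sum_eq_zero fun j _ => ?_
      rcases lt_or_ge (height j) (height k) with h | h
      · rw [hv.raise k j h, smul_zero]
      · rw [hX.apply_eq_zero hα h, mul_zero, zero_smul]
    · change f _ v = 0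
      rw [map_sub, LinearMap.sub_apply, hf, hv.weight, AlgHom.commutes,
        Module.algebraMap_end_apply, sub_self]
  intro htop
  have : (1 : U n) ∈ I := hI (htop ▸ Submodule.mem_top)
  apply hv0
  have h1 : f 1 v = 0 := this
  simpa using h1

/-- A `U`-submodule as a Lie submodule of the Verma module. -/
def vermaLieSubmodule {n : ℕ} {lam : Wt n} (N : Submodule (U n) (Verma lam)) :
    LieSubmodule ℂ (𝔤 n) (Verma lam) :=
  { N.restrictScalars ℂ with lie_mem := fun {X _} hm => N.smul_mem (ιU n X) hm }

/-- The cosingular functional of the Verma module descends to the quotient. It is cogenerating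
there: a submodule in its kernel has a preimage that misses the generator, hence a proper one, which
lies in the radical. -/
theorem exists_isSimpleHighestWeight_L {n : ℕ} {μ : Wt n} (hμ : vermaIdeal μ ≠ ⊤) :
    ∃ (v : L μ) (φ : L μ →ₗ[ℂ] ℂ), IsSimpleHighestWeight μ v φ := by
  have hgen := lieSpan_vermaGen μ
  have hsing := isSingular_vermaGen μ
  have hv0 : vermaGen μ ≠ 0 := by
    intro h
    rw [vermaGen, Submodule.Quotient.mk_eq_zero] at h
    exact hμ ((Ideal.eq_top_iff_one _).2 h)
  obtain ⟨φ, hφ, hφv⟩ := hsing.exists_cosingular hgen hv0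
  -- A submodule on which `φ` does not vanish is everything, so `φ` vanishes on every proper
  -- submodule and therefore on their sum.
  have hker : (vermaRadical μ).restrictScalars ℂ ≤ LinearMap.ker φ := by
    intro m hm
    rw [LinearMap.mem_ker]
    rw [Submodule.restrictScalars_mem, vermaRadical, sSup_eq_iSup'] at hm
    refine Submodule.iSup_induction _ (motive := fun m => φ m = 0) hm ?_ (map_zero φ) ?_
    · rintro ⟨N, hN⟩ m hmN
      by_contra hφm
      apply hN
      have := hsing.eq_top_of_ne_zero hgen hφ (vermaLieSubmodule N) hmN hφm
      rw [← top_le_iff]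
      intro x _
      have hx : x ∈ vermaLieSubmodule N := this ▸ LieSubmodule.mem_top x
      exact hx
    · intro x y hx hy; rw [map_add, hx, hy, add_zero]
  let q : Verma μ →ₗ[U n] L μ := (vermaRadical μ).mkQ
  have hq : Function.Surjective q := Submodule.mkQ_surjective _
  let ψ : L μ →ₗ[ℂ] ℂ := (((vermaRadical μ).restrictScalars ℂ).liftQ φ hker).comp
    (Submodule.Quotient.restrictScalarsEquiv ℂ (vermaRadical μ)).symm.toLinearMap
  have hψ : ∀ m, ψ (q m) = φ m := fun m => rfl
  have hql : ∀ (X : 𝔤 n) m, q ⁅X, m⁆ = ⁅X, q m⁆ := fun X m => map_smul q _ _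
  have hqs : ∀ (c : ℂ) m, q (c • m) = c • q m := fun c m => rfl
  refine ⟨q (vermaGen μ), ψ, ⟨fun k j h => ?_, fun H => ?_⟩, ⟨fun k j h m => ?_, fun H m => ?_⟩,
    ?_, ?_, ?_⟩
  · rw [← hql, hsing.raise k j h, map_zero]
  · rw [← hql, hsing.weight, hqs]
  · obtain ⟨m, rfl⟩ := hq m
    rw [← hql, hψ, hφ.lower k j h]
  · obtain ⟨m, rfl⟩ := hq m
    rw [← hql, hψ, hψ, hφ.weight]
  · rw [← top_le_iff]
    intro m _
    obtain ⟨m, rfl⟩ := hq m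
    obtain ⟨u, rfl⟩ := Submodule.Quotient.mk_surjective _ m
    rw [← smul_vermaGen, map_smul]
    refine U_smul_mem (LieSubmodule.lieSpan ℂ (𝔤 n) {q (vermaGen μ)}).toSubmodule
      (fun X m hm => LieSubmodule.lie_mem _ hm) u ?_
    exact LieSubmodule.subset_lieSpan rfl
  · intro N hN
    let N' : Submodule (U n) (Verma μ) :=
      { carrier := {m | q m ∈ N}
        add_mem' := fun {a b} ha hb => by
          simp only [Set.mem_ofPred_eq, map_add] at *; exact N.add_mem ha hb
        zero_mem' := by simp
        smul_mem' := fun u a ha => by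
          simp only [Set.mem_ofPred_eq, map_smul] at *
          exact U_smul_mem N.toSubmodule (fun X m hm => N.lie_mem hm) u ha }
    have hN' : N' ≤ vermaRadical μ := by
      refine le_sSup ?_
      intro htop
      have : vermaGen μ ∈ N' := htop ▸ Submodule.mem_top
      exact hφv (hN _ this)
    rw [eq_bot_iff]
    intro m hm
    obtain ⟨m, rfl⟩ := hq m
    rw [LieSubmodule.mem_bot]
    exact (Submodule.Quotient.mk_eq_zero _).2 (hN' hm)
  · rw [hψ]; exact hφv

/-! ### Uniqueness of the simple module of a given highest weight. -/

section Uniqueness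

variable {n : ℕ} {M M' : Type*} [AddCommGroup M] [Module ℂ M] [LieRingModule (𝔤 n) M]
  [LieModule ℂ (𝔤 n) M] [AddCommGroup M'] [Module ℂ M'] [LieRingModule (𝔤 n) M']
  [LieModule ℂ (𝔤 n) M']

instance prodLieRingModule : LieRingModule (𝔤 n) (M × M') where
  bracket X p := (⁅X, p.1⁆, ⁅X, p.2⁆)
  add_lie X Y p := Prod.ext (add_lie X Y p.1) (add_lie X Y p.2)
  lie_add X p q := Prod.ext (lie_add X p.1 q.1) (lie_add X p.2 q.2)
  leibniz_lie X Y p := Prod.ext (leibniz_lie X Y p.1) (leibniz_lie X Y p.2)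

instance prodLieModule : LieModule ℂ (𝔤 n) (M × M') where
  smul_lie c X p := Prod.ext (smul_lie c X p.1) (smul_lie c X p.2)
  lie_smul c X p := Prod.ext (lie_smul c X p.1) (lie_smul c X p.2)

omit [Module ℂ M] [Module ℂ M'] [LieModule ℂ (𝔤 n) M] [LieModule ℂ (𝔤 n) M'] in
theorem prod_lie (X : 𝔤 n) (p : M × M') : ⁅X, p⁆ = (⁅X, p.1⁆, ⁅X, p.2⁆) := rfl

omit [LieModule ℂ (𝔤 n) M] in
theorem lieSpan_singleton_eq_top (v : M) (hv : v ∈ LieSubmodule.lieSpan ℂ (𝔤 n) {v}) :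
    LieSubmodule.lieSpan ℂ (𝔤 n) {(⟨v, hv⟩ : LieSubmodule.lieSpan ℂ (𝔤 n) {v})} = ⊤ := by
  rw [← top_le_iff]
  rintro ⟨m, hm⟩ -
  induction hm using LieSubmodule.lieSpan_induction with
  | mem x h => exact LieSubmodule.subset_lieSpan (Subtype.ext h)
  | zero => exact LieSubmodule.zero_mem _
  | add x y hx hy h1 h2 => exact add_mem h1 h2
  | smul a x hx h => exact SMulMemClass.smul_mem a h
  | lie x y hy h => exact LieSubmodule.lie_mem _ h

/-- On the Lie submodule generated by a singular vector, a cosingular functional is determined by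
its value at the generator. -/
theorem IsSingular.eq_zero_of_mem_lieSpan {μ : Wt n} {v : M} (hv : IsSingular μ v)
    {φ : M →ₗ[ℂ] ℂ} (hφ : IsCosingular μ φ) (h0 : φ v = 0) {m : M}
    (hm : m ∈ LieSubmodule.lieSpan ℂ (𝔤 n) {v}) : φ m = 0 := by
  have hvm : v ∈ LieSubmodule.lieSpan ℂ (𝔤 n) {v} := LieSubmodule.subset_lieSpan rfl
  set N := LieSubmodule.lieSpan ℂ (𝔤 n) {v}
  have hs : IsSingular μ (⟨v, hvm⟩ : N) :=
    ⟨fun k j h => Subtype.ext (hv.raise k j h), fun H => Subtype.ext (hv.weight H)⟩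
  have hc : IsCosingular μ (φ.comp (N.incl : N →ₗ[ℂ] M)) :=
    ⟨fun k j h m => hφ.lower k j h m, fun H m => hφ.weight H m⟩
  obtain ⟨a, m', hm', he⟩ := hs.exists_eq (lieSpan_singleton_eq_top v hvm) ⟨m, hm⟩
  have h1 := hc.eq_zero_of_mem_lowerSpan hm'
  have h2 := congrArg (φ.comp (N.incl : N →ₗ[ℂ] M)) he
  rw [map_add, h1, add_zero, map_smul] at h2
  have h3 : (φ.comp (N.incl : N →ₗ[ℂ] M)) ⟨v, hvm⟩ = 0 := h0
  rw [h3, smul_zero] at h2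
  exact h2

/-- A bijective homomorphism of Lie modules is an equivalence. -/
def lieModuleEquivOfBijective (f : M →ₗ⁅ℂ, 𝔤 n⁆ M') (hf : Function.Bijective f) :
    M ≃ₗ⁅ℂ, 𝔤 n⁆ M' :=
  { f with
    invFun := (Equiv.ofBijective f hf).symm
    left_inv := (Equiv.ofBijective f hf).left_inv
    right_inv := (Equiv.ofBijective f hf).right_inv }

/-- The submodule of `M × M'` generated by `(v, v')` is the graph of an isomorphism. Its
intersections with the two factors are killed by `φ` and by `φ'`, hence are zero by cogeneration. -/
theorem lieSpan_pair_fst_bijective {μ : Wt n} {v : M} {φ : M →ₗ[ℂ] ℂ} {v' : M'}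
    {φ' : M' →ₗ[ℂ] ℂ} (h : IsSimpleHighestWeight μ v φ) (h' : IsSimpleHighestWeight μ v' φ') :
    Function.Bijective (fun p : LieSubmodule.lieSpan ℂ (𝔤 n) {(v, v')} => (p : M × M').1) ∧
    Function.Bijective (fun p : LieSubmodule.lieSpan ℂ (𝔤 n) {(v, v')} => (p : M × M').2) := by
  set P := LieSubmodule.lieSpan ℂ (𝔤 n) {(v, v')}
  have hvP : (v, v') ∈ P := LieSubmodule.subset_lieSpan rfl
  have hs : IsSingular μ (v, v') :=
    ⟨fun k j hkj => Prod.ext (h.singular.raise k j hkj) (h'.singular.raise k j hkj),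
      fun H => Prod.ext (h.singular.weight H) (h'.singular.weight H)⟩
  -- This combination is chosen to vanish at `(v, v')`; being cosingular of the same weight, it then
  -- vanishes on all of `P`.
  let Φ : M × M' →ₗ[ℂ] ℂ := φ' v' • φ.comp (LinearMap.fst ℂ M M') -
    φ v • φ'.comp (LinearMap.snd ℂ M M')
  have hΦ : ∀ p, Φ p = φ' v' * φ p.1 - φ v * φ' p.2 := fun p => rfl
  have hc : IsCosingular μ Φ := by
    refine ⟨fun k j hkj m => ?_, fun H m => ?_⟩
    · rw [hΦ, prod_lie, h.cosingular.lower k j hkj, h'.cosingular.lower k j hkj]; ring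
    · rw [hΦ, hΦ, prod_lie, h.cosingular.weight, h'.cosingular.weight]; ring
  have hP : ∀ p ∈ P, φ' v' * φ p.1 = φ v * φ' p.2 := by
    intro p hp
    have := hs.eq_zero_of_mem_lieSpan hc (by rw [hΦ]; ring) hp
    rw [hΦ] at this
    linear_combination this
  refine ⟨⟨?_, ?_⟩, ⟨?_, ?_⟩⟩
  · rintro ⟨⟨a, b⟩, hp⟩ ⟨⟨a', b'⟩, hp'⟩ hab
    obtain rfl : a = a' := hab
    let N : LieSubmodule ℂ (𝔤 n) M' :=
      { carrier := {m | ((0 : M), m) ∈ P}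
        add_mem' := fun {x y} hx hy => by
          have := P.add_mem hx hy
          rwa [Prod.mk_add_mk, add_zero] at this
        zero_mem' := P.zero_mem
        smul_mem' := fun c x hx => by
          have := P.smul_mem c hx
          rwa [Prod.smul_mk, smul_zero] at this
        lie_mem := fun {X m} hm => by
          have := P.lie_mem (x := X) hm
          rwa [prod_lie, lie_zero] at this }
    have hN : N = ⊥ := h'.cogen N fun m hm => by
      have := hP _ hm
      simp only [map_zero, mul_zero] at this
      exact (mul_eq_zero.1 this.symm).resolve_left h.ne_zero
    have hb : b - b' ∈ N := by
      have := P.sub_mem hp hp'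
      rwa [Prod.mk_sub_mk, sub_self] at this
    rw [hN, LieSubmodule.mem_bot, sub_eq_zero] at hb
    subst hb; rfl
  · intro m
    let N : LieSubmodule ℂ (𝔤 n) M :=
      { (P.toSubmodule.map (LinearMap.fst ℂ M M')) with
        lie_mem := by
          rintro X _ ⟨p, hp, rfl⟩
          exact ⟨⁅X, p⁆, P.lie_mem hp, rfl⟩ }
    have hN : (⊤ : LieSubmodule ℂ (𝔤 n) M) ≤ N := by
      rw [← h.gen, LieSubmodule.lieSpan_le, Set.singleton_subset_iff]
      exact ⟨_, hvP, rfl⟩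
    obtain ⟨p, hp, rfl⟩ := hN (LieSubmodule.mem_top m)
    exact ⟨⟨p, hp⟩, rfl⟩
  · rintro ⟨⟨a, b⟩, hp⟩ ⟨⟨a', b'⟩, hp'⟩ hab
    obtain rfl : b = b' := hab
    let N : LieSubmodule ℂ (𝔤 n) M :=
      { carrier := {m | (m, (0 : M')) ∈ P}
        add_mem' := fun {x y} hx hy => by
          have := P.add_mem hx hy
          rwa [Prod.mk_add_mk, add_zero] at this
        zero_mem' := P.zero_mem
        smul_mem' := fun c x hx => by
          have := P.smul_mem c hx
          rwa [Prod.smul_mk, smul_zero] at this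
        lie_mem := fun {X m} hm => by
          have := P.lie_mem (x := X) hm
          rwa [prod_lie, lie_zero] at this }
    have hN : N = ⊥ := h.cogen N fun m hm => by
      have := hP _ hm
      simp only [map_zero, mul_zero] at this
      exact (mul_eq_zero.1 this).resolve_left h'.ne_zero
    have hb : a - a' ∈ N := by
      have := P.sub_mem hp hp'
      rwa [Prod.mk_sub_mk, sub_self] at this
    rw [hN, LieSubmodule.mem_bot, sub_eq_zero] at hb
    subst hb; rfl
  · intro m
    let N : LieSubmodule ℂ (𝔤 n) M' :=
      { (P.toSubmodule.map (LinearMap.snd ℂ M M')) with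
        lie_mem := by
          rintro X _ ⟨p, hp, rfl⟩
          exact ⟨⁅X, p⁆, P.lie_mem hp, rfl⟩ }
    have hN : (⊤ : LieSubmodule ℂ (𝔤 n) M') ≤ N := by
      rw [← h'.gen, LieSubmodule.lieSpan_le, Set.singleton_subset_iff]
      exact ⟨_, hvP, rfl⟩
    obtain ⟨p, hp, rfl⟩ := hN (LieSubmodule.mem_top m)
    exact ⟨⟨p, hp⟩, rfl⟩

theorem IsSimpleHighestWeight.nonempty_equiv {μ : Wt n} {v : M} {φ : M →ₗ[ℂ] ℂ} {v' : M'}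
    {φ' : M' →ₗ[ℂ] ℂ} (h : IsSimpleHighestWeight μ v φ) (h' : IsSimpleHighestWeight μ v' φ') :
    Nonempty (M ≃ₗ⁅ℂ, 𝔤 n⁆ M') := by
  obtain ⟨h1, h2⟩ := lieSpan_pair_fst_bijective h h'
  let f1 : LieSubmodule.lieSpan ℂ (𝔤 n) {(v, v')} →ₗ⁅ℂ, 𝔤 n⁆ M :=
    { (LinearMap.fst ℂ M M').comp (LieSubmodule.toSubmodule _).subtype with
      map_lie' := fun {X m} => rfl }
  let f2 : LieSubmodule.lieSpan ℂ (𝔤 n) {(v, v')} →ₗ⁅ℂ, 𝔤 n⁆ M' :=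
    { (LinearMap.snd ℂ M M').comp (LieSubmodule.toSubmodule _).subtype with
      map_lie' := fun {X m} => rfl }
  exact ⟨(lieModuleEquivOfBijective f1 h1).symm.trans (lieModuleEquivOfBijective f2 h2)⟩

end Uniqueness

/-! ### Sums over basis vectors ordered by height. -/

section Indices

variable {n : ℕ}

theorem height_induction {p : Fin n ⊕ Fin n → Prop}
    (h : ∀ k, (∀ j, height k < height j → p j) → p k) (k : Fin n ⊕ Fin n) : p k := by
  have hle : ∀ j : Fin n ⊕ Fin n, height j ≤ n := by
    rintro (j | j) <;> simp only [height, Sum.elim_inl, Sum.elim_inr] <;> omega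
  induction hd : ((n : ℤ) - height k).toNat using Nat.strong_induction_on generalizing k with
  | _ d ih =>
    exact h k fun j hj => ih _ (by have := hle k; have := hle j; omega) j rfl

/-- The coefficient with which `elt k j` maps `e_j` to `e_k`. -/
def mult (k j : Fin n ⊕ Fin n) : ℂ := if j = k.swap then 2 else 1

theorem sum_split {A : Type*} [AddCommMonoid A] (f : Fin n ⊕ Fin n → A) (k : Fin n ⊕ Fin n) :
    ∑ j, f j = f k + ∑ j with height k < height j, f j + ∑ j with height j < height k, f j := by
  rw [← Finset.sum_filter_add_sum_filter_not Finset.univ (fun j => height j < height k)]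
  rw [add_comm]
  congr 1
  have : Finset.univ.filter (fun j => ¬ height j < height k) =
      insert k (Finset.univ.filter fun j => height k < height j) := by
    ext j
    simp only [Finset.mem_filter, Finset.mem_univ, true_and, Finset.mem_insert, not_lt]
    rw [le_iff_eq_or_lt, height_injective.eq_iff, eq_comm]
  rw [this, Finset.sum_insert (by simp)]

/-- This count of higher basis vectors is the reason for the shift by `n` in the Casimir operator:
`n` minus this sum is `height k`, a coordinate of `±ρ`. -/
theorem sum_mult (k : Fin n ⊕ Fin n) :
    ∑ j with height k < height j, mult k j = (n : ℂ) - height k := by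
  rw [Finset.sum_filter, Fintype.sum_sum_type]
  rcases k with i | i
  · have e1 : ∀ j : Fin n, (if height (Sum.inl i) < height (Sum.inl j) then
        mult (Sum.inl i) (Sum.inl j) else 0) = if j ∈ Finset.Iio i then 1 else 0 := fun j => by
      refine if_congr ?_ (by simp [mult]) rfl
      simp [height]
    have e2 : ∀ j : Fin n, (if height (Sum.inl i) < height (Sum.inr j) then
        mult (Sum.inl i) (Sum.inr j) else 0) = 0 := fun j => by
      refine if_neg ?_
      simp only [height, Sum.elim_inl, Sum.elim_inr]; omega
    rw [Finset.sum_congr rfl fun j _ => e1 j, Finset.sum_congr rfl fun j _ => e2 j]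
    simp only [Finset.sum_const, nsmul_eq_mul, mul_one, mul_zero, add_zero, Finset.sum_ite_mem,
      Finset.univ_inter, Fin.card_Iio, height, Sum.elim_inl]
    push_cast; ring
  · have e1 : ∀ j : Fin n, (if height (Sum.inr i) < height (Sum.inl j) then
        mult (Sum.inr i) (Sum.inl j) else 0) = 1 + if j = i then 1 else 0 := fun j => by
      rw [if_pos (by simp only [height, Sum.elim_inl, Sum.elim_inr]; omega), mult]
      by_cases h : j = i
      · simp [h]; norm_num
      · simp [h]
    have e2 : ∀ j : Fin n, (if height (Sum.inr i) < height (Sum.inr j) then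
        mult (Sum.inr i) (Sum.inr j) else 0) = if j ∈ Finset.Ioi i then 1 else 0 := fun j => by
      refine if_congr ?_ (by simp [mult]) rfl
      simp [height]
    rw [Finset.sum_congr rfl fun j _ => e1 j, Finset.sum_congr rfl fun j _ => e2 j,
      Finset.sum_add_distrib]
    have h2 : i.val + 1 ≤ n := i.2
    simp only [Finset.sum_const, Finset.card_univ, Fintype.card_fin, nsmul_eq_mul, mul_one,
      Finset.sum_ite_eq', Finset.mem_univ, if_true, Finset.sum_ite_mem, Finset.univ_inter,
      Fin.card_Ioi, height, Sum.elim_inr]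
    rw [Nat.sub_sub, Nat.cast_sub (by omega)]
    push_cast; ring

end Indices

/-! ### The shifted split Casimir operator and its triangular form. -/

section Tensor

variable {n : ℕ} {M : Type*} [AddCommGroup M] [Module ℂ M] [LieRingModule (𝔤 n) M]
  [LieModule ℂ (𝔤 n) M]

/-- The standard basis of `ℂ²ⁿ`. -/
def stdVec (k : Fin n ⊕ Fin n) : Fin n ⊕ Fin n → ℂ := Pi.single k 1

theorem lie_vec (X : 𝔤 n) (w : Fin n ⊕ Fin n → ℂ) (k : Fin n ⊕ Fin n) :
    ⁅X, w⁆ k = ∑ l, (X : Matrix _ _ ℂ) k l * w l := rfl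

variable (M) in
/-- The components of an element of `M ⊗ ℂ²ⁿ`. -/
def comp (k : Fin n ⊕ Fin n) : M ⊗[ℂ] (Fin n ⊕ Fin n → ℂ) →ₗ[ℂ] M :=
  (TensorProduct.rid ℂ M).toLinearMap ∘ₗ (LinearMap.proj k).lTensor M

omit [LieRingModule (𝔤 n) M] [LieModule ℂ (𝔤 n) M] in
theorem comp_tmul (k : Fin n ⊕ Fin n) (m : M) (w : Fin n ⊕ Fin n → ℂ) :
    comp M k (m ⊗ₜ w) = w k • m := by
  simp [comp]

omit [LieRingModule (𝔤 n) M] [LieModule ℂ (𝔤 n) M] in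
theorem comp_stdVec (k j : Fin n ⊕ Fin n) (m : M) :
    comp M k (m ⊗ₜ stdVec j) = if k = j then m else 0 := by
  rw [comp_tmul, stdVec, Pi.single_apply]; split_ifs <;> simp

omit [LieRingModule (𝔤 n) M] [LieModule ℂ (𝔤 n) M] in
theorem sum_comp_tmul (x : M ⊗[ℂ] (Fin n ⊕ Fin n → ℂ)) : ∑ k, comp M k x ⊗ₜ stdVec k = x := by
  induction x with
  | zero => simp
  | add x y hx hy =>
    simp only [map_add, TensorProduct.add_tmul, Finset.sum_add_distrib]
    rw [hx, hy]
  | tmul m w =>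
    simp only [comp_tmul, TensorProduct.smul_tmul]
    rw [← TensorProduct.tmul_sum]
    congr 1
    ext k
    simp [stdVec, Pi.single_apply]

omit [LieRingModule (𝔤 n) M] [LieModule ℂ (𝔤 n) M] in
theorem comp_ext {x y : M ⊗[ℂ] (Fin n ⊕ Fin n → ℂ)} (h : ∀ k, comp M k x = comp M k y) :
    x = y := by
  rw [← sum_comp_tmul x, ← sum_comp_tmul y]
  simp only [h]

theorem comp_lie (k : Fin n ⊕ Fin n) (X : 𝔤 n) (x : M ⊗[ℂ] (Fin n ⊕ Fin n → ℂ)) :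
    comp M k ⁅X, x⁆ = ⁅X, comp M k x⁆ + ∑ l, (X : Matrix _ _ ℂ) k l • comp M l x := by
  induction x with
  | zero => simp
  | add x y hx hy =>
    simp only [map_add, lie_add, smul_add, Finset.sum_add_distrib]
    rw [hx, hy]; abel
  | tmul m w =>
    rw [TensorProduct.LieModule.lie_tmul_right, map_add]
    simp only [comp_tmul, lie_smul, lie_vec, Finset.sum_smul, mul_smul]

variable (n M) in
/-- The shifted split Casimir operator on `M ⊗ ℂ²ⁿ`. -/
def casimir : Module.End ℂ (M ⊗[ℂ] (Fin n ⊕ Fin n → ℂ)) :=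
  (n : ℂ) • LinearMap.id + ∑ k, ∑ j, TensorProduct.map (LieModule.toEnd ℂ (𝔤 n) M (elt k j))
    (LinearMap.single ℂ (fun _ => ℂ) j ∘ₗ LinearMap.proj k)

theorem comp_casimir (j : Fin n ⊕ Fin n) (x : M ⊗[ℂ] (Fin n ⊕ Fin n → ℂ)) :
    comp M j (casimir n M x) = (n : ℂ) • comp M j x + ∑ k, ⁅(elt k j : 𝔤 n), comp M k x⁆ := by
  induction x with
  | zero => simp
  | add x y hx hy =>
    simp only [map_add, lie_add, smul_add, Finset.sum_add_distrib]
    rw [hx, hy]; abel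
  | tmul m w =>
    simp only [casimir, LinearMap.add_apply, LinearMap.smul_apply, LinearMap.id_apply, map_add,
      map_smul, LinearMap.sum_apply, map_sum, TensorProduct.map_tmul, comp_tmul,
      LinearMap.comp_apply, LinearMap.proj_apply, LinearMap.single_apply, lie_smul]
    congr 1
    refine Finset.sum_congr rfl fun k _ => ?_
    rw [Finset.sum_eq_single j]
    · simp
    · intro b _ hb; simp [hb.symm]
    · simp

/-- By `lie_elt`, the first tensor factors transform like matrix units, and the two sums they
produce cancel against the action of `X` on the second factor. -/
theorem casimir_lie (X : 𝔤 n) (x : M ⊗[ℂ] (Fin n ⊕ Fin n → ℂ)) :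
    casimir n M ⁅X, x⁆ = ⁅X, casimir n M x⁆ := by
  refine comp_ext fun j => ?_
  simp only [comp_casimir, comp_lie, lie_add, smul_add, lie_smul, Finset.sum_add_distrib,
    _root_.lie_sum, Finset.smul_sum]
  have h1 : ∀ k, ⁅X, ⁅(elt k j : 𝔤 n), comp M k x⁆⁆ = ⁅(elt k j : 𝔤 n), ⁅X, comp M k x⁆⁆ +
      ∑ l, (X : Matrix _ _ ℂ) l k • ⁅(elt l j : 𝔤 n), comp M k x⁆ -
      ∑ l, (X : Matrix _ _ ℂ) j l • ⁅(elt k l : 𝔤 n), comp M k x⁆ := by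
    intro k
    rw [leibniz_lie, lie_elt, sub_lie, _root_.sum_lie, _root_.sum_lie]
    simp only [smul_lie]; abel
  simp only [h1, Finset.sum_add_distrib, Finset.sum_sub_distrib]
  rw [Finset.sum_comm (f := fun k l => (X : Matrix _ _ ℂ) l k • ⁅(elt l j : 𝔤 n), comp M k x⁆),
    Finset.sum_comm (f := fun k l => (X : Matrix _ _ ℂ) j l • ⁅(elt k l : 𝔤 n), comp M k x⁆)]
  have h2 : ∀ l, (n : ℂ) • (X : Matrix _ _ ℂ) j l • comp M l x =
      (X : Matrix _ _ ℂ) j l • (n : ℂ) • comp M l x := fun l => smul_comm _ _ _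
  simp only [h2]
  abel

theorem elt_apply_same (a j l : Fin n ⊕ Fin n) :
    (elt a j : Matrix _ _ ℂ) a l = if l = j then mult a j else 0 := by
  rw [elt_apply, mult]
  by_cases h1 : j = a.swap
  · subst h1
    simp only [Sum.swap_swap, if_true, sgn_swap]
    split_ifs
    · linear_combination sgn_mul_self a
    · ring
  · have : ¬ a = j.swap := fun h => h1 (by rw [h, Sum.swap_swap])
    simp [h1, this]

theorem elt_lie_stdVec (a j : Fin n ⊕ Fin n) :
    ⁅(elt a j : 𝔤 n), stdVec j⁆ = mult a j • stdVec (n := n) a := by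
  ext l
  rw [lie_vec]
  simp only [stdVec, Pi.single_apply, mul_ite, mul_one, mul_zero, Finset.sum_ite_eq',
    Finset.mem_univ, if_true, Pi.smul_apply, smul_eq_mul]
  rw [elt_apply, mult]
  by_cases h1 : j = a.swap
  · subst h1
    simp only [Sum.swap_swap, if_true, sgn_swap]
    split_ifs
    · linear_combination sgn_mul_self a
    · ring
  · simp [h1]

/-- The eigenvalues of the shifted split Casimir operator on `L(μ) ⊗ ℂ²ⁿ`. -/
def cas (μ : Wt n) (k : Fin n ⊕ Fin n) : ℂ := μ (cartanElt k) + height k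

theorem cartanElt_swap (k : Fin n ⊕ Fin n) : cartanElt k.swap = - cartanElt k := by
  apply Subtype.ext; apply Subtype.ext
  ext a b
  simp only [NegMemClass.coe_neg, coe_cartanElt, Matrix.neg_apply, elt_apply, Sum.swap_swap,
    sgn_mul_self]
  ring

theorem cas_swap (μ : Wt n) (k : Fin n ⊕ Fin n) : cas μ k.swap = - cas μ k := by
  rw [cas, cas, cartanElt_swap, height_swap, map_neg]; push_cast; ring

theorem IsSingular.elt_lie_tmul {μ : Wt n} {v : M} (hv : IsSingular μ v) {a k : Fin n ⊕ Fin n}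
    (h : height k < height a) :
    ⁅(elt a k : 𝔤 n), v ⊗ₜ[ℂ] stdVec k⁆ = mult a k • (v ⊗ₜ[ℂ] stdVec a) := by
  rw [TensorProduct.LieModule.lie_tmul_right, hv.raise _ _ h, TensorProduct.zero_tmul, zero_add,
    elt_lie_stdVec, TensorProduct.tmul_smul]

theorem mult_comm (k j : Fin n ⊕ Fin n) : mult k j = mult j k := by
  have : (j = k.swap) = (k = j.swap) := by
    apply propext; constructor <;> (rintro rfl; simp)
  simp only [mult, this]

/-- Moving `elt k j` from the first factor to the tensor product costs `mult k j • (v ⊗ e_k)`. The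
terms with `j` below `k` vanish by singularity, and the costs add up by `sum_mult`: triangularity
with diagonal entry `cas μ k`. -/
theorem IsSingular.casimir_tmul {μ : Wt n} {v : M} (hv : IsSingular μ v) (k : Fin n ⊕ Fin n) :
    casimir n M (v ⊗ₜ stdVec k) = cas μ k • (v ⊗ₜ[ℂ] stdVec k) +
      ∑ j with height k < height j, ⁅(elt k j : 𝔤 n), v ⊗ₜ[ℂ] stdVec j⁆ := by
  have h1 : casimir n M (v ⊗ₜ stdVec k) = (n : ℂ) • (v ⊗ₜ[ℂ] stdVec k) +
      ∑ j, ⁅(elt k j : 𝔤 n), v⁆ ⊗ₜ[ℂ] stdVec j := by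
    refine comp_ext fun j => ?_
    rw [comp_casimir]
    simp only [map_add, map_sum, comp_stdVec, map_smul]
    simp [Finset.sum_ite_eq, apply_ite]
  have h2 : ∀ j, ⁅(elt k j : 𝔤 n), v ⊗ₜ[ℂ] stdVec j⁆ =
      ⁅(elt k j : 𝔤 n), v⁆ ⊗ₜ[ℂ] stdVec j + mult k j • (v ⊗ₜ[ℂ] stdVec k) := by
    intro j
    rw [TensorProduct.LieModule.lie_tmul_right, elt_lie_stdVec, TensorProduct.tmul_smul]
  have h3 : ∑ j with height j < height k, ⁅(elt k j : 𝔤 n), v⁆ ⊗ₜ[ℂ] stdVec (n := n) j = 0 := by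
    refine Finset.sum_eq_zero fun j hj => ?_
    rw [hv.raise k j (Finset.mem_filter.1 hj).2, TensorProduct.zero_tmul]
  rw [h1, sum_split _ k, h3, ← coe_cartanElt, hv.weight]
  simp only [h2, Finset.sum_add_distrib]
  rw [← Finset.sum_smul, sum_mult, cas, ← TensorProduct.smul_tmul']
  module

/-- The transpose of the triangularity for singular vectors: here the terms with `a` below `j` are
lowering operators, which `φ` kills. -/
theorem IsCosingular.comp_casimir {μ : Wt n} {φ : M →ₗ[ℂ] ℂ} (hφ : IsCosingular μ φ)
    (j : Fin n ⊕ Fin n) (x : M ⊗[ℂ] (Fin n ⊕ Fin n → ℂ)) :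
    φ (comp M j (casimir n M x)) = cas μ j * φ (comp M j x) +
      ∑ a with height j < height a, φ (comp M a ⁅(elt a j : 𝔤 n), x⁆) := by
  have h2 : ∀ a, φ (comp M a ⁅(elt a j : 𝔤 n), x⁆) =
      φ ⁅(elt a j : 𝔤 n), comp M a x⁆ + mult j a * φ (comp M j x) := by
    intro a
    rw [comp_lie, map_add, map_sum]
    simp only [elt_apply_same, ite_smul, zero_smul]
    simp [apply_ite, mult_comm a j]
  have h3 : ∑ a with height a < height j, φ ⁅(elt a j : 𝔤 n), comp M a x⁆ = 0 := by
    refine Finset.sum_eq_zero fun a ha => ?_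
    rw [hφ.lower a j (Finset.mem_filter.1 ha).2]
  rw [SymplecticTensor.comp_casimir, map_add, map_sum, map_smul, sum_split _ j, h3,
    ← coe_cartanElt, hφ.weight]
  simp only [h2, Finset.sum_add_distrib]
  rw [← Finset.sum_mul, sum_mult, cas, smul_eq_mul]
  ring

end Tensor

/-! ### Decomposition of the tensor product into Casimir eigenspaces. -/

open Polynomial in
theorem X_sub_C_mul_basis {ι : Type*} [Fintype ι] [DecidableEq ι] (y : ι → ℂ) (l : ι) :
    ∃ c : ℂ, (X - C (y l)) * Lagrange.basis Finset.univ y l = C c * ∏ k, (X - C (y k)) := by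
  refine ⟨∏ k ∈ Finset.univ.erase l, (y l - y k)⁻¹, ?_⟩
  rw [Lagrange.basis, ← Finset.mul_prod_erase Finset.univ _ (Finset.mem_univ l)]
  simp only [Lagrange.basisDivisor, Finset.prod_mul_distrib, map_prod]
  ring

section Decomposition

variable {n : ℕ} {M : Type*} [AddCommGroup M] [Module ℂ M] [LieRingModule (𝔤 n) M]
  [LieModule ℂ (𝔤 n) M]

open Polynomial in
theorem aeval_casimir_lie (p : ℂ[X]) (Z : 𝔤 n) (x : M ⊗[ℂ] (Fin n ⊕ Fin n → ℂ)) :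
    aeval (casimir n M) p ⁅Z, x⁆ = ⁅Z, aeval (casimir n M) p x⁆ := by
  induction p using Polynomial.induction_on' with
  | add p q hp hq => rw [map_add, LinearMap.add_apply, LinearMap.add_apply, hp, hq, lie_add]
  | monomial d c =>
    rw [aeval_monomial, Module.End.mul_apply, Module.End.mul_apply, Module.algebraMap_end_apply,
      Module.algebraMap_end_apply, lie_smul]
    congr 1
    induction d with
    | zero => simp
    | succ d ih => rw [pow_succ', Module.End.mul_apply, Module.End.mul_apply, ih, casimir_lie]

theorem tensor_eq_top {v : M} (hgen : LieSubmodule.lieSpan ℂ (𝔤 n) {v} = ⊤)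
    (N : LieSubmodule ℂ (𝔤 n) (M ⊗[ℂ] (Fin n ⊕ Fin n → ℂ))) (hN : ∀ k, v ⊗ₜ stdVec k ∈ N) :
    N = ⊤ := by
  have hN' : ∀ w : Fin n ⊕ Fin n → ℂ, v ⊗ₜ w ∈ N := by
    intro w
    have : v ⊗ₜ[ℂ] w = ∑ k, w k • (v ⊗ₜ[ℂ] stdVec k) := by
      rw [← sum_comp_tmul (v ⊗ₜ[ℂ] w)]
      simp only [comp_tmul, TensorProduct.smul_tmul']
    rw [this]
    exact sum_mem fun k _ => SMulMemClass.smul_mem _ (hN k)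
  let K : LieSubmodule ℂ (𝔤 n) M :=
    { carrier := {m | ∀ w : Fin n ⊕ Fin n → ℂ, m ⊗ₜ w ∈ N}
      add_mem' := fun ha hb w => by rw [TensorProduct.add_tmul]; exact add_mem (ha w) (hb w)
      zero_mem' := fun w => by rw [TensorProduct.zero_tmul]; exact zero_mem N
      smul_mem' := fun c a ha w => by
        rw [← TensorProduct.smul_tmul']; exact SMulMemClass.smul_mem _ (ha w)
      lie_mem := fun {X m} hm w => by
        have h1 : ⁅X, m⁆ ⊗ₜ[ℂ] w = ⁅X, m ⊗ₜ[ℂ] w⁆ - m ⊗ₜ[ℂ] ⁅X, w⁆ := by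
          rw [TensorProduct.LieModule.lie_tmul_right]; abel
        rw [h1]
        exact sub_mem (N.lie_mem (hm w)) (hm _) }
  have hK : (⊤ : LieSubmodule ℂ (𝔤 n) M) ≤ K := by
    rw [← hgen, LieSubmodule.lieSpan_le, Set.singleton_subset_iff]
    exact hN'
  rw [← top_le_iff]
  intro x _
  rw [← sum_comp_tmul x]
  exact sum_mem fun k _ => hK (LieSubmodule.mem_top _) _

/-- Dual to `tensor_eq_top`: the components of the elements of `N` span a Lie submodule of `M`, and
it lies in the kernel of `φ`. -/
theorem tensor_eq_bot {φ : M →ₗ[ℂ] ℂ}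
    (hco : ∀ N : LieSubmodule ℂ (𝔤 n) M, (∀ m ∈ N, φ m = 0) → N = ⊥)
    (N : LieSubmodule ℂ (𝔤 n) (M ⊗[ℂ] (Fin n ⊕ Fin n → ℂ)))
    (hN : ∀ x ∈ N, ∀ k, φ (comp M k x) = 0) : N = ⊥ := by
  let S : Submodule ℂ M := Submodule.span ℂ {y | ∃ k, ∃ x ∈ N, y = comp M k x}
  have hS : ∀ k, ∀ x ∈ N, comp M k x ∈ S := fun k x hx => Submodule.subset_span ⟨k, x, hx, rfl⟩
  let K : LieSubmodule ℂ (𝔤 n) M :=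
    { S with
      lie_mem := fun {X m} hm => by
        change m ∈ S at hm
        change ⁅X, m⁆ ∈ S
        refine Submodule.span_induction ?_ ?_ ?_ ?_ hm
        · rintro _ ⟨k, x, hx, rfl⟩
          have : ⁅X, comp M k x⁆ = comp M k ⁅X, x⁆ -
              ∑ l, (X : Matrix _ _ ℂ) k l • comp M l x := by rw [comp_lie]; abel
          rw [this]
          exact S.sub_mem (hS _ _ (N.lie_mem hx))
            (S.sum_mem fun l _ => S.smul_mem _ (hS l x hx))
        · rw [lie_zero]; exact S.zero_mem
        · intro x y _ _ hx hy; rw [lie_add]; exact S.add_mem hx hy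
        · intro c x _ hx; rw [lie_smul]; exact S.smul_mem c hx }
  have hK : K = ⊥ := hco K fun m hm => by
    change m ∈ S at hm
    refine Submodule.span_induction ?_ ?_ ?_ ?_ hm
    · rintro _ ⟨k, x, hx, rfl⟩; exact hN x hx k
    · exact map_zero φ
    · intro x y _ _ hx hy; rw [map_add, hx, hy, add_zero]
    · intro c x _ hx; rw [map_smul, hx, smul_zero]
  rw [eq_bot_iff]
  intro x hx
  rw [LieSubmodule.mem_bot]
  refine comp_ext fun k => ?_
  have : comp M k x ∈ K := hS k x hx
  rw [hK, LieSubmodule.mem_bot] at this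
  rw [this, map_zero]

variable (M) in
/-- The eigenspace of the shifted split Casimir operator for the eigenvalue `cas μ k`. -/
def casSpace (μ : Wt n) (k : Fin n ⊕ Fin n) :
    LieSubmodule ℂ (𝔤 n) (M ⊗[ℂ] (Fin n ⊕ Fin n → ℂ)) :=
  { (casimir n M).eigenspace (cas μ k) with
    lie_mem := fun {X m} hm => by
      change m ∈ (casimir n M).eigenspace (cas μ k) at hm
      change ⁅X, m⁆ ∈ (casimir n M).eigenspace (cas μ k)
      rw [Module.End.mem_eigenspace_iff] at *
      rw [casimir_lie, hm, lie_smul] }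

theorem mem_casSpace {μ : Wt n} {k : Fin n ⊕ Fin n} {x : M ⊗[ℂ] (Fin n ⊕ Fin n → ℂ)} :
    x ∈ casSpace M μ k ↔ casimir n M x = cas μ k • x := Module.End.mem_eigenspace_iff

variable (M) in
/-- The Lagrange projection to an eigenspace of the shifted split Casimir operator. -/
def casProj (μ : Wt n) (k : Fin n ⊕ Fin n) : Module.End ℂ (M ⊗[ℂ] (Fin n ⊕ Fin n → ℂ)) :=
  Polynomial.aeval (casimir n M) (Lagrange.basis Finset.univ (cas μ) k)

theorem casProj_lie (μ : Wt n) (k : Fin n ⊕ Fin n) (Z : 𝔤 n)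
    (x : M ⊗[ℂ] (Fin n ⊕ Fin n → ℂ)) : casProj M μ k ⁅Z, x⁆ = ⁅Z, casProj M μ k x⁆ :=
  aeval_casimir_lie _ _ _

theorem casProj_casimir (μ : Wt n) (k : Fin n ⊕ Fin n) (x : M ⊗[ℂ] (Fin n ⊕ Fin n → ℂ)) :
    casProj M μ k (casimir n M x) = casimir n M (casProj M μ k x) := by
  have h := congrArg (fun p => Polynomial.aeval (casimir n M) p x)
    (mul_comm (Lagrange.basis Finset.univ (cas μ) k) Polynomial.X)
  simp only [map_mul, Polynomial.aeval_X, Module.End.mul_apply] at h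
  exact h

theorem casProj_of_mem {μ : Wt n} (hy : Function.Injective (cas μ)) {k l : Fin n ⊕ Fin n}
    {x : M ⊗[ℂ] (Fin n ⊕ Fin n → ℂ)} (hx : x ∈ casSpace M μ k) :
    casProj M μ l x = if k = l then x else 0 := by
  rw [casProj, Module.End.aeval_apply_of_mem_apply_eq_smul (mem_casSpace.1 hx)]
  split_ifs with h
  · subst h
    rw [Lagrange.eval_basis_self hy.injOn (Finset.mem_univ _), one_smul]
  · rw [Lagrange.eval_basis_of_ne (Ne.symm h) (Finset.mem_univ _), zero_smul]

theorem sum_casProj {μ : Wt n} (hn : 0 < n) (hy : Function.Injective (cas μ))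
    (x : M ⊗[ℂ] (Fin n ⊕ Fin n → ℂ)) : ∑ l, casProj M μ l x = x := by
  simp only [casProj]
  rw [← LinearMap.sum_apply, ← map_sum, Lagrange.sum_basis hy.injOn
    ⟨Sum.inl ⟨0, hn⟩, Finset.mem_univ _⟩, map_one, Module.End.one_apply]

open Polynomial in
theorem aeval_prod_tmul {μ : Wt n} {v : M} (hv : IsSingular μ v) (k : Fin n ⊕ Fin n) :
    ∀ S : Finset (Fin n ⊕ Fin n), (∀ j, height k ≤ height j → j ∈ S) →
      aeval (casimir n M) (∏ j ∈ S, (X - C (cas μ j))) (v ⊗ₜ stdVec k) = 0 := by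
  induction k using height_induction with
  | h k ih =>
  intro S hS
  -- The factor of index `k`, applied first, leaves only terms coming from `v ⊗ e_j` with `j` above
  -- `k`. The set with `k` removed still contains everything from such a `j` upwards, so induction
  -- applies.
  rw [← Finset.prod_erase_mul S _ (hS k le_rfl), map_mul, Module.End.mul_apply, map_sub, aeval_X,
    aeval_C, LinearMap.sub_apply, Module.algebraMap_end_apply, hv.casimir_tmul,
    add_sub_cancel_left, map_sum]
  refine Finset.sum_eq_zero fun j hj => ?_
  have hj' := (Finset.mem_filter.1 hj).2
  rw [aeval_casimir_lie, ih j hj', lie_zero]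
  intro i hi
  rw [Finset.mem_erase]
  exact ⟨fun h => by subst h; omega, hS i (by omega)⟩

-- The product of all `X - cas μ j` annihilates the tensor product, since it kills the generators `v
-- ⊗ e_k`, and a Lagrange basis polynomial times its missing factor is a multiple of that product.
open Polynomial in
theorem casProj_mem {μ : Wt n} {v : M} (hv : IsSingular μ v)
    (hgen : LieSubmodule.lieSpan ℂ (𝔤 n) {v} = ⊤) (l : Fin n ⊕ Fin n)
    (x : M ⊗[ℂ] (Fin n ⊕ Fin n → ℂ)) : casProj M μ l x ∈ casSpace M μ l := by
  let K : LieSubmodule ℂ (𝔤 n) (M ⊗[ℂ] (Fin n ⊕ Fin n → ℂ)) :=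
    { LinearMap.ker (aeval (casimir n M) (∏ j, (X - C (cas μ j)))) with
      lie_mem := fun {Z m} hm => by
        change aeval (casimir n M) _ m = 0 at hm
        change aeval (casimir n M) _ ⁅Z, m⁆ = 0
        rw [aeval_casimir_lie, hm, lie_zero] }
  have hK : K = ⊤ := tensor_eq_top hgen K fun k =>
    aeval_prod_tmul hv k Finset.univ fun j _ => Finset.mem_univ j
  have hx : aeval (casimir n M) (∏ j, (X - C (cas μ j))) x = 0 := by
    have : x ∈ K := hK ▸ LieSubmodule.mem_top x
    exact this
  obtain ⟨c, hc⟩ := X_sub_C_mul_basis (cas μ) l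
  have h1 := congrArg (fun p => aeval (casimir n M) p x) hc
  simp only [map_mul, Module.End.mul_apply, hx, map_sub, aeval_X, aeval_C, LinearMap.sub_apply,
    Module.algebraMap_end_apply, smul_zero] at h1
  rw [mem_casSpace]
  exact sub_eq_zero.1 h1

theorem casProj_tmul_rec {μ : Wt n} {v : M} (hv : IsSingular μ v)
    (hgen : LieSubmodule.lieSpan ℂ (𝔤 n) {v} = ⊤) (l k : Fin n ⊕ Fin n) :
    (cas μ l - cas μ k) • casProj M μ l (v ⊗ₜ stdVec k) =
      ∑ j with height k < height j, ⁅(elt k j : 𝔤 n), casProj M μ l (v ⊗ₜ[ℂ] stdVec j)⁆ := by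
  have h1 := congrArg (casProj M μ l) (hv.casimir_tmul k)
  rw [casProj_casimir, mem_casSpace.1 (casProj_mem hv hgen l _), map_add, map_smul, map_sum] at h1
  simp only [casProj_lie] at h1
  rw [sub_smul, h1, add_sub_cancel_left]

/-- Downward induction in the recursion: the right-hand side involves only still higher vectors, and
the scalar on the left is nonzero because the eigenvalues are distinct. -/
theorem casProj_tmul_eq_zero {μ : Wt n} {v : M} (hv : IsSingular μ v)
    (hgen : LieSubmodule.lieSpan ℂ (𝔤 n) {v} = ⊤) (hy : Function.Injective (cas μ))
    {l : Fin n ⊕ Fin n} (k : Fin n ⊕ Fin n) :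
    height l < height k → casProj M μ l (v ⊗ₜ stdVec k) = 0 := by
  induction k using height_induction with
  | h k ih =>
  intro hlk
  have h1 := casProj_tmul_rec hv hgen l k
  rw [Finset.sum_eq_zero] at h1
  · refine (smul_eq_zero.1 h1).resolve_left (sub_ne_zero.2 fun h => ?_)
    have := hy h
    subst this; omega
  · intro j hj
    have hj' := (Finset.mem_filter.1 hj).2
    rw [ih j hj' (by omega), lie_zero]

/-- The projections of all `v ⊗ e_k` generate the eigenspace. Those above `l` vanish, and the
recursion expresses those below through higher ones with an invertible coefficient. -/
theorem casSpace_eq_lieSpan {μ : Wt n} {v : M} (hv : IsSingular μ v)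
    (hgen : LieSubmodule.lieSpan ℂ (𝔤 n) {v} = ⊤) (hy : Function.Injective (cas μ))
    (l : Fin n ⊕ Fin n) :
    casSpace M μ l = LieSubmodule.lieSpan ℂ (𝔤 n) {casProj M μ l (v ⊗ₜ stdVec l)} := by
  set W := LieSubmodule.lieSpan ℂ (𝔤 n) {casProj M μ l (v ⊗ₜ stdVec l)}
  refine le_antisymm ?_ ?_
  · let K : LieSubmodule ℂ (𝔤 n) (M ⊗[ℂ] (Fin n ⊕ Fin n → ℂ)) :=
      { W.toSubmodule.comap (casProj M μ l) with
        lie_mem := fun {Z m} hm => by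
          change casProj M μ l m ∈ W at hm
          change casProj M μ l ⁅Z, m⁆ ∈ W
          rw [casProj_lie]; exact W.lie_mem hm }
    have hKk : ∀ k, casProj M μ l (v ⊗ₜ stdVec k) ∈ W := by
      intro k
      induction k using height_induction with
      | h k ih =>
      by_cases hkl : k = l
      · subst hkl; exact LieSubmodule.subset_lieSpan rfl
      · have hne : cas μ l - cas μ k ≠ 0 := sub_ne_zero.2 fun h => hkl (hy h).symm
        have h1 := casProj_tmul_rec hv hgen l k
        have h2 : (cas μ l - cas μ k) • casProj M μ l (v ⊗ₜ stdVec k) ∈ W := by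
          rw [h1]
          exact sum_mem fun j hj => W.lie_mem (ih j (Finset.mem_filter.1 hj).2)
        have h3 := W.smul_mem (cas μ l - cas μ k)⁻¹ h2
        rwa [smul_smul, inv_mul_cancel₀ hne, one_smul] at h3
    have hK : K = ⊤ := tensor_eq_top hgen K hKk
    intro x hx
    have h1 := casProj_of_mem hy (l := l) hx
    rw [if_pos rfl] at h1
    have h2 : x ∈ K := hK ▸ LieSubmodule.mem_top x
    change casProj M μ l x ∈ W at h2
    rwa [h1] at h2
  · rw [LieSubmodule.lieSpan_le, Set.singleton_subset_iff]
    exact casProj_mem hv hgen l _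

theorem lie_cartan_stdVec (H : 𝔥 n) (k : Fin n ⊕ Fin n) :
    ⁅(H : 𝔤 n), stdVec (n := n) k⁆ = wt k H • stdVec (n := n) k := by
  have hd : ((H : 𝔤 n) : Matrix (Fin n ⊕ Fin n) (Fin n ⊕ Fin n) ℂ).IsDiag := H.2
  ext l
  rw [lie_vec]
  simp only [stdVec, Pi.single_apply, mul_ite, mul_one, mul_zero, Finset.sum_ite_eq',
    Finset.mem_univ, if_true, Pi.smul_apply, smul_eq_mul]
  split_ifs with h
  · subst h; rw [wt_apply]
  · exact hd h

theorem isSingular_casProj {μ : Wt n} {v : M} (hv : IsSingular μ v)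
    (hgen : LieSubmodule.lieSpan ℂ (𝔤 n) {v} = ⊤) (hy : Function.Injective (cas μ))
    (l : Fin n ⊕ Fin n) : IsSingular (μ + wt l) (casProj M μ l (v ⊗ₜ stdVec l)) where
  raise k j h := by
    rw [← casProj_lie, TensorProduct.LieModule.lie_tmul_right, hv.raise k j h,
      TensorProduct.zero_tmul, zero_add, ← sum_comp_tmul (v ⊗ₜ ⁅(elt k j : 𝔤 n), stdVec l⁆), map_sum]
    refine Finset.sum_eq_zero fun a _ => ?_
    rw [comp_tmul, ← TensorProduct.smul_tmul', map_smul]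
    -- A raising operator moves `e_l` only to vectors above it, and the projection of index `l`
    -- kills those components.
    by_cases ha : height l < height a
    · rw [casProj_tmul_eq_zero hv hgen hy a ha, smul_zero]
    · rw [lie_vec]
      simp only [stdVec, Pi.single_apply, mul_ite, mul_one, mul_zero, Finset.sum_ite_eq',
        Finset.mem_univ, if_true]
      rw [elt_apply]
      have h1 : ¬ (a = k ∧ l = j) := by rintro ⟨rfl, rfl⟩; exact ha h
      have h2 : ¬ (a = j.swap ∧ l = k.swap) := by
        rintro ⟨rfl, rfl⟩; rw [height_swap, height_swap] at ha; omega
      simp only [← ite_and, h1, h2, if_false]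
      simp
  weight H := by
    rw [← casProj_lie, TensorProduct.LieModule.lie_tmul_right, hv.weight, lie_cartan_stdVec,
      TensorProduct.tmul_smul, ← TensorProduct.smul_tmul', ← add_smul, map_smul]
    rfl

theorem functional_eq_zero {μ : Wt n} {φ : M →ₗ[ℂ] ℂ} (hφ : IsCosingular μ φ)
    (hy : Function.Injective (cas μ)) {l : Fin n ⊕ Fin n} (j : Fin n ⊕ Fin n) :
    height l < height j → ∀ x ∈ casSpace M μ l, φ (comp M j x) = 0 := by
  induction j using height_induction with
  | h j ih =>
  intro hlj x hx
  have h1 := hφ.comp_casimir j x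
  rw [mem_casSpace.1 hx, map_smul, map_smul, Finset.sum_eq_zero, add_zero, smul_eq_mul] at h1
  · have h2 : (cas μ l - cas μ j) * φ (comp M j x) = 0 := by rw [sub_mul, h1, sub_self]
    refine (mul_eq_zero.1 h2).resolve_left (sub_ne_zero.2 fun h => ?_)
    have := hy h
    subst this; omega
  · intro a ha
    have ha' := (Finset.mem_filter.1 ha).2
    exact ih a ha' (by omega) _ (LieSubmodule.lie_mem _ hx)

variable (M) in
/-- The functional `φ ⊗ e_l^*` restricted to the eigenspace with index `l`. -/
def casFunctional (μ : Wt n) (φ : M →ₗ[ℂ] ℂ) (l : Fin n ⊕ Fin n) : casSpace M μ l →ₗ[ℂ] ℂ :=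
  (φ.comp (comp M l)).comp ((casSpace M μ l).incl : casSpace M μ l →ₗ[ℂ] _)

theorem isCosingular_casFunctional {μ : Wt n} {φ : M →ₗ[ℂ] ℂ} (hφ : IsCosingular μ φ)
    (hy : Function.Injective (cas μ)) (l : Fin n ⊕ Fin n) :
    IsCosingular (μ + wt l) (casFunctional M μ φ l) where
  lower k j h m := by
    change φ (comp M l ⁅(elt k j : 𝔤 n), (m : M ⊗[ℂ] (Fin n ⊕ Fin n → ℂ))⁆) = 0
    rw [comp_lie, map_add, hφ.lower k j h, zero_add, map_sum]
    refine Finset.sum_eq_zero fun a _ => ?_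
    rw [map_smul]
    by_cases ha : height l < height a
    · rw [functional_eq_zero hφ hy a ha _ m.2, smul_zero]
    · rw [elt_apply]
      have h1 : ¬ (l = k ∧ a = j) := by rintro ⟨rfl, rfl⟩; exact ha h
      have h2 : ¬ (l = j.swap ∧ a = k.swap) := by
        rintro ⟨rfl, rfl⟩; rw [height_swap, height_swap] at ha; omega
      simp only [← ite_and, h1, h2, if_false]
      simp
  weight H m := by
    have hd : ((H : 𝔤 n) : Matrix (Fin n ⊕ Fin n) (Fin n ⊕ Fin n) ℂ).IsDiag := H.2
    change φ (comp M l ⁅(H : 𝔤 n), (m : M ⊗[ℂ] (Fin n ⊕ Fin n → ℂ))⁆) =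
      (μ H + wt l H) * φ (comp M l m)
    rw [comp_lie, map_add, hφ.weight, Finset.sum_eq_single l, ← wt_apply, map_smul, smul_eq_mul]
    · ring
    · intro b _ hb; rw [hd hb.symm, zero_smul]
    · simp

/-- On the eigenspace, the vanishing of `φ ∘ comp M l` propagates downward through the transposed
recursion to all `φ ∘ comp M j`, which together cogenerate the tensor product. -/
theorem casFunctional_cogen {μ : Wt n} {v : M} {φ : M →ₗ[ℂ] ℂ}
    (h : IsSimpleHighestWeight μ v φ) (hy : Function.Injective (cas μ)) (l : Fin n ⊕ Fin n)
    (N : LieSubmodule ℂ (𝔤 n) (M ⊗[ℂ] (Fin n ⊕ Fin n → ℂ))) (hNl : N ≤ casSpace M μ l)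
    (hN : ∀ x ∈ N, φ (comp M l x) = 0) : N = ⊥ := by
  refine tensor_eq_bot h.cogen N fun x hx j => ?_
  revert x
  induction j using height_induction with
  | h j ih =>
  intro x hx
  by_cases hlj : j = l
  · subst hlj; exact hN x hx
  have h1 := h.cosingular.comp_casimir j x
  rw [mem_casSpace.1 (hNl hx), map_smul, map_smul, Finset.sum_eq_zero, add_zero, smul_eq_mul] at h1
  · have h2 : (cas μ l - cas μ j) * φ (comp M j x) = 0 := by rw [sub_mul, h1, sub_self]
    exact (mul_eq_zero.1 h2).resolve_left (sub_ne_zero.2 fun h => hlj (hy h).symm)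
  · intro a ha
    exact ih a (Finset.mem_filter.1 ha).2 _ (N.lie_mem hx)

/-- The leading coefficient of the projected vector; up to normalization, its squared norm. -/
def leadCoeff (μ : Wt n) (v : M) (φ : M →ₗ[ℂ] ℂ) (k l : Fin n ⊕ Fin n) : ℂ :=
  φ (comp M k (casProj M μ l (v ⊗ₜ stdVec k)))

theorem isSingular_casSpace {μ : Wt n} {v : M} (hv : IsSingular μ v)
    (hgen : LieSubmodule.lieSpan ℂ (𝔤 n) {v} = ⊤) (hy : Function.Injective (cas μ))
    (l : Fin n ⊕ Fin n) :
    IsSingular (μ + wt l) (⟨_, casProj_mem hv hgen l (v ⊗ₜ stdVec l)⟩ : casSpace M μ l) :=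
  ⟨fun k j h => Subtype.ext ((isSingular_casProj hv hgen hy l).raise k j h),
    fun H => Subtype.ext ((isSingular_casProj hv hgen hy l).weight H)⟩

theorem lieSpan_casSpace {μ : Wt n} {v : M} (hv : IsSingular μ v)
    (hgen : LieSubmodule.lieSpan ℂ (𝔤 n) {v} = ⊤) (hy : Function.Injective (cas μ))
    (l : Fin n ⊕ Fin n) :
    LieSubmodule.lieSpan ℂ (𝔤 n)
      {(⟨_, casProj_mem hv hgen l (v ⊗ₜ stdVec l)⟩ : casSpace M μ l)} = ⊤ := by
  have key : ∀ (N : LieSubmodule ℂ (𝔤 n) (M ⊗[ℂ] (Fin n ⊕ Fin n → ℂ))) (w) (hw : w ∈ N),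
      N = LieSubmodule.lieSpan ℂ (𝔤 n) {w} →
      LieSubmodule.lieSpan ℂ (𝔤 n) {(⟨w, hw⟩ : N)} = ⊤ := by
    intro N w hw hN
    subst hN
    exact lieSpan_singleton_eq_top w hw
  exact key _ _ _ (casSpace_eq_lieSpan hv hgen hy l)

/-- If the functional vanishes at the generator, it vanishes on the whole eigenspace; but it
cogenerates the eigenspace. -/
theorem casSpace_eq_bot {μ : Wt n} {v : M} {φ : M →ₗ[ℂ] ℂ} (h : IsSimpleHighestWeight μ v φ)
    (hy : Function.Injective (cas μ)) (l : Fin n ⊕ Fin n) (h0 : leadCoeff μ v φ l l = 0) :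
    casSpace M μ l = ⊥ := by
  refine casFunctional_cogen h hy l _ le_rfl fun x hx => ?_
  exact (isSingular_casSpace h.singular h.gen hy l).eq_zero_of_mem_lieSpan
    (isCosingular_casFunctional h.cosingular hy l) h0 (m := ⟨x, hx⟩)
    (by rw [lieSpan_casSpace h.singular h.gen hy l]; exact LieSubmodule.mem_top _)

theorem isSimpleHighestWeight_casSpace {μ : Wt n} {v : M} {φ : M →ₗ[ℂ] ℂ}
    (h : IsSimpleHighestWeight μ v φ) (hy : Function.Injective (cas μ)) (l : Fin n ⊕ Fin n)
    (h0 : leadCoeff μ v φ l l ≠ 0) :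
    IsSimpleHighestWeight (μ + wt l) (⟨_, casProj_mem h.singular h.gen l (v ⊗ₜ stdVec l)⟩ :
      casSpace M μ l) (casFunctional M μ φ l) where
  singular := isSingular_casSpace h.singular h.gen hy l
  cosingular := isCosingular_casFunctional h.cosingular hy l
  gen := lieSpan_casSpace h.singular h.gen hy l
  cogen N hN := by
    have h1 : N.map (casSpace M μ l).incl = ⊥ := by
      refine casFunctional_cogen h hy l _ ?_ ?_
      · intro x hx
        obtain ⟨y, _, rfl⟩ := (LieSubmodule.mem_map _).1 hx
        exact y.2
      · intro x hx
        obtain ⟨y, hy', rfl⟩ := (LieSubmodule.mem_map _).1 hx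
        exact hN y hy'
    rw [eq_bot_iff]
    intro x hx
    have h2 : (casSpace M μ l).incl x ∈ N.map (casSpace M μ l).incl :=
      (LieSubmodule.mem_map _).2 ⟨x, hx, rfl⟩
    rw [h1, LieSubmodule.mem_bot] at h2
    rw [LieSubmodule.mem_bot]
    exact Subtype.ext h2
  ne_zero := h0

theorem leadCoeff_eq_zero {μ : Wt n} {v : M} {φ : M →ₗ[ℂ] ℂ} (h : IsSimpleHighestWeight μ v φ)
    (hy : Function.Injective (cas μ)) {k l : Fin n ⊕ Fin n} (hkl : height l < height k) :
    leadCoeff μ v φ k l = 0 := by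
  rw [leadCoeff, casProj_tmul_eq_zero h.singular h.gen hy k hkl, map_zero, map_zero]

theorem sum_leadCoeff {μ : Wt n} {v : M} {φ : M →ₗ[ℂ] ℂ} (hn : 0 < n)
    (hy : Function.Injective (cas μ)) (k : Fin n ⊕ Fin n) :
    ∑ l, leadCoeff μ v φ k l = φ v := by
  simp only [leadCoeff]
  rw [← map_sum, ← map_sum, sum_casProj hn hy, comp_stdVec, if_pos rfl]

/-- The projection commutes with `elt a k`, which turns `v ⊗ e_k` into a multiple of `v ⊗ e_a`. The
transposed triangularity thus closes into a scalar system. -/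
theorem leadCoeff_rec {μ : Wt n} {v : M} {φ : M →ₗ[ℂ] ℂ} (h : IsSimpleHighestWeight μ v φ)
    (k l : Fin n ⊕ Fin n) :
    (cas μ l - cas μ k) * leadCoeff μ v φ k l =
      ∑ a with height k < height a, mult k a * leadCoeff μ v φ a l := by
  have h1 := h.cosingular.comp_casimir k (casProj M μ l (v ⊗ₜ stdVec k))
  rw [mem_casSpace.1 (casProj_mem h.singular h.gen l _), map_smul, map_smul, smul_eq_mul] at h1
  rw [sub_mul, leadCoeff, h1, add_sub_cancel_left]
  refine Finset.sum_congr rfl fun a ha => ?_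
  rw [← casProj_lie, h.singular.elt_lie_tmul (Finset.mem_filter.1 ha).2, map_smul, map_smul,
    map_smul, smul_eq_mul, mult_comm, leadCoeff]

end Decomposition

/-! ### Solution of the scalar recursions. -/

section Recursion

open Finset

/-- The partial sums obey a first-order homogeneous recurrence, so they telescope to `c ∏ (z + 1 - X
j) / (z - X j)`. -/
theorem partial_sum_rec {B X : ℕ → ℂ} {c z : ℂ} {j : ℕ}
    (hB : (z - X j) * B j = c + ∑ i ∈ range j, B i) :
    (z - X j) * (c + ∑ i ∈ range (j + 1), B i) = (z + 1 - X j) * (c + ∑ i ∈ range j, B i) := by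
  rw [sum_range_succ]; linear_combination hB

theorem partial_sum_ne_zero_iff {B X : ℕ → ℂ} {c z : ℂ} (hc : c ≠ 0) (m : ℕ)
    (hB : ∀ j < m, (z - X j) * B j = c + ∑ i ∈ range j, B i) (hz : ∀ j < m, z ≠ X j) :
    c + ∑ i ∈ range m, B i ≠ 0 ↔ ∀ j < m, z + 1 ≠ X j := by
  induction m with
  | zero => simpa using hc
  | succ m ih =>
    have h1 := partial_sum_rec (hB m (Nat.lt_succ_self m))
    have h2 := ih (fun j hj => hB j (by omega)) (fun j hj => hz j (by omega))
    have h3 : z - X m ≠ 0 := sub_ne_zero.2 (hz m (Nat.lt_succ_self m))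
    rw [Nat.forall_lt_succ_right, ← h2]
    constructor
    · intro h
      have h4 := mul_ne_zero h3 h
      rw [h1] at h4
      exact ⟨right_ne_zero_of_mul h4, sub_ne_zero.1 (left_ne_zero_of_mul h4)⟩
    · rintro ⟨h4, h5⟩
      have h6 := mul_ne_zero (sub_ne_zero.2 h5) h4
      rw [← h1] at h6
      exact right_ne_zero_of_mul h6

/-- The tails `T_j = c + ∑ B + ∑_{a ≥ j} B' a` satisfy `(z + X j) T_j = (z + 1 + X j) T_{j+1} + B
j`. After multiplication by `2z + 1`, minus the partial sum of `B` is a particular solution, and the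
product solves the homogeneous equation. -/
theorem backward_sum_eq {n : ℕ} {B B' X : ℕ → ℂ} {c z : ℂ} {i : ℕ}
    (hB : ∀ j < n, (z - X j) * B j = c + ∑ a ∈ range j, B a)
    (hB' : ∀ j < n, i < j → (z + X j) * B' j =
      c + ∑ a ∈ range n, B a + B j + ∑ a ∈ Ico (j + 1) n, B' a)
    (hz' : ∀ j < n, i < j → z + X j ≠ 0) (d : ℕ) (hd : d ≤ n) (hid : i < n - d) :
    (2 * z + 1) * (c + ∑ a ∈ range n, B a + ∑ a ∈ Ico (n - d) n, B' a) =
      (2 * z + 2) * ((c + ∑ a ∈ range n, B a) *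
        ∏ a ∈ Ico (n - d) n, ((z + 1 + X a) / (z + X a))) - (c + ∑ a ∈ range (n - d), B a) := by
  induction d with
  | zero => simp; ring
  | succ d ih =>
    obtain ⟨j, hj⟩ : ∃ j, j = n - (d + 1) := ⟨_, rfl⟩
    have hjd : n - d = j + 1 := by omega
    rw [hjd] at ih
    rw [← hj] at hid ⊢
    have ih := ih (by omega) (by omega)
    have hjn : j < n := by omega
    rw [sum_eq_sum_Ico_succ_bot hjn, prod_eq_prod_Ico_succ_bot hjn]
    have h1 := hB j hjn
    have h2 := hB' j hjn hid
    have h3 := hz' j hjn hid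
    rw [sum_range_succ] at ih
    set D := c + ∑ a ∈ range n, B a
    set P := ∏ a ∈ Ico (j + 1) n, ((z + 1 + X a) / (z + X a))
    set S := ∑ a ∈ Ico (j + 1) n, B' a
    set E := ∑ a ∈ range j, B a
    have h4 : (z + X j) * ((z + 1 + X j) / (z + X j)) = z + 1 + X j := by field_simp
    set q := (z + 1 + X j) / (z + X j)
    apply mul_left_cancel₀ h3
    linear_combination (2 * z + 1) * h2 + (z + X j + 1) * ih - (2 * z + 2) * D * P * h4 + h1

/-- Here `z = -X i` is the eigenvalue attached to the lower basis vector of index `i`. The last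
index is treated separately, because `2z + 1` may vanish there. -/
theorem lead_ne_zero_iff {n : ℕ} {B B' X : ℕ → ℂ} {c g : ℂ} (hc : c ≠ 0) {i : ℕ} (hi : i < n)
    (hB : ∀ j < n, (- X i - X j) * B j = c + ∑ a ∈ range j, B a)
    (hB' : ∀ j < n, i < j → (- X i + X j) * B' j =
      c + ∑ a ∈ range n, B a + B j + ∑ a ∈ Ico (j + 1) n, B' a)
    (hg : g = c + ∑ a ∈ range n, B a + B i + ∑ a ∈ Ico (i + 1) n, B' a)
    (hz : ∀ j < n, - X i ≠ X j) (hz' : ∀ j < n, i < j → - X i + X j ≠ 0)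
    (h1 : X i ≠ 1) (h2 : i + 1 < n → 2 * X i ≠ 1) :
    g ≠ 0 ↔ (∀ j < n, j ≠ i → X i + X j ≠ 1) ∧ (∀ j < n, i < j → X i - 1 ≠ X j) := by
  have hBi := hB i hi
  have hzi : (-2 * X i + 2) ≠ 0 := fun h => h1 (by linear_combination -(1 / 2 : ℂ) * h)
  by_cases hin : i + 1 = n
  · subst hin
    -- For the last index there is no tail: `g` is the full partial sum plus `B i`, and the
    -- recursion for `B i` rewrites the earlier terms as `-2 X i * B i`.
    have hgB : g = (-2 * X i + 2) * B i := by
      rw [hg, Finset.Ico_self, sum_empty, sum_range_succ]; linear_combination -hBi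
    have hz3 : (- X i - X i) ≠ 0 := sub_ne_zero.2 (hz i hi)
    have h3 := partial_sum_ne_zero_iff hc i (fun j hj => hB j (by omega))
      (fun j hj => hz j (by omega))
    rw [← hBi] at h3
    have h4 : g ≠ 0 ↔ (- X i - X i) * B i ≠ 0 := by
      rw [hgB, mul_ne_zero_iff, mul_ne_zero_iff, and_iff_right hzi, and_iff_right hz3]
    rw [h4, h3]
    constructor
    · intro h
      refine ⟨fun j hj hji he => h j (by omega) ?_, fun j hj hj' => by omega⟩
      linear_combination -he
    · intro h j hj he
      exact h.1 j (by omega) (by omega) (by linear_combination -he)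
  · have hin' : i + 1 < n := by omega
    have h5 := backward_sum_eq hB hB' hz' (n - (i + 1)) (by omega) (by omega)
    rw [show n - (n - (i + 1)) = i + 1 by omega] at h5
    have h6 : (2 * (- X i) + 1) ≠ 0 := fun h => h2 hin' (by linear_combination -h)
    -- The extra `B i` in `g` exactly cancels the inhomogeneous term: `2z * B i` is the partial sum
    -- before `i`, so `(2z + 1) * B i` is the one through `i`.
    have h7 : (2 * (- X i) + 1) * g = (2 * (- X i) + 2) * ((c + ∑ a ∈ range n, B a) *
        ∏ a ∈ Ico (i + 1) n, ((- X i + 1 + X a) / (- X i + X a))) := by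
      rw [sum_range_succ _ i] at h5
      rw [hg]
      linear_combination h5 + hBi
    have h8 : g ≠ 0 ↔ (c + ∑ a ∈ range n, B a) ≠ 0 ∧
        ∏ a ∈ Ico (i + 1) n, ((- X i + 1 + X a) / (- X i + X a)) ≠ 0 := by
      have hzi' : (2 * (- X i) + 2) ≠ 0 := fun h => hzi (by linear_combination h)
      have : g ≠ 0 ↔ (2 * (- X i) + 1) * g ≠ 0 := by rw [mul_ne_zero_iff, and_iff_right h6]
      rw [this, h7, mul_ne_zero_iff, mul_ne_zero_iff, and_iff_right hzi']
    rw [h8, partial_sum_ne_zero_iff hc n hB hz, prod_ne_zero_iff]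
    refine and_congr ⟨fun h j hj hji he => h j hj ?_, fun h j hj he => ?_⟩
      ⟨fun h j hj hij he => ?_, fun h j hj => ?_⟩
    · linear_combination -he
    · by_cases hji : j = i
      · subst hji; exact h2 hin' (by linear_combination -he)
      · exact h j hj hji (by linear_combination -he)
    · refine h j (mem_Ico.2 ⟨hij, hj⟩) ?_
      rw [show - X i + 1 + X j = 0 by linear_combination -he, zero_div]
    · rw [mem_Ico] at hj
      refine div_ne_zero (fun he => h j hj.2 hj.1 ?_) (hz' j hj.2 hj.1)
      linear_combination -he

end Recursion

/-! ### Reindexing of sums over higher basis vectors by natural numbers. -/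

section Conversion

variable {n : ℕ}

/-- Extension by zero of a function on `Fin n`. -/
def extendZero (f : Fin n → ℂ) (j : ℕ) : ℂ := if h : j < n then f ⟨j, h⟩ else 0

theorem extendZero_val (f : Fin n → ℂ) (j : Fin n) : extendZero f j = f j := by
  simp [extendZero]

theorem sum_ite_eq_sum_extendZero (f : Fin n → ℂ) (P : ℕ → Prop) [DecidablePred P] :
    ∑ j : Fin n, (if P j then f j else 0) = ∑ j ∈ Finset.range n with P j, extendZero f j := by
  rw [Finset.sum_fin_eq_sum_range, Finset.sum_filter]
  refine Finset.sum_congr rfl fun j hj => ?_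
  rw [dif_pos (Finset.mem_range.1 hj), extendZero, dif_pos (Finset.mem_range.1 hj)]

theorem sum_higher_inl (f : Fin n ⊕ Fin n → ℂ) (i : Fin n) :
    ∑ a with height (Sum.inl i) < height a, mult (Sum.inl i) a * f a =
      ∑ j ∈ Finset.range i, extendZero (fun j => f (Sum.inl j)) j := by
  rw [Finset.sum_filter, Fintype.sum_sum_type]
  have e1 : ∀ j : Fin n, (if height (Sum.inl i) < height (Sum.inl j) then
      mult (Sum.inl i) (Sum.inl j) * f (Sum.inl j) else 0) =
      if j.val < i.val then f (Sum.inl j) else 0 := fun j => by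
    refine if_congr ?_ (by simp [mult]) rfl
    simp [height]
  have e2 : ∀ j : Fin n, (if height (Sum.inl i) < height (Sum.inr j) then
      mult (Sum.inl i) (Sum.inr j) * f (Sum.inr j) else 0) = 0 := fun j => by
    refine if_neg ?_
    simp only [height, Sum.elim_inl, Sum.elim_inr]; omega
  rw [Finset.sum_congr rfl fun j _ => e1 j, Finset.sum_congr rfl fun j _ => e2 j,
    sum_ite_eq_sum_extendZero (fun j => f (Sum.inl j)) (· < i.val), Finset.sum_const_zero, add_zero]
  refine Finset.sum_congr ?_ fun _ _ => rfl
  ext j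
  have := i.2
  simp only [Finset.mem_filter, Finset.mem_range]; omega

theorem sum_higher_inr (f : Fin n ⊕ Fin n → ℂ) (i : Fin n) :
    ∑ a with height (Sum.inr i) < height a, mult (Sum.inr i) a * f a =
      ∑ j ∈ Finset.range n, extendZero (fun j => f (Sum.inl j)) j +
      extendZero (fun j => f (Sum.inl j)) i +
      ∑ j ∈ Finset.Ico (i.val + 1) n, extendZero (fun j => f (Sum.inr j)) j := by
  rw [Finset.sum_filter, Fintype.sum_sum_type]
  have e1 : ∀ j : Fin n, (if height (Sum.inr i) < height (Sum.inl j) then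
      mult (Sum.inr i) (Sum.inl j) * f (Sum.inl j) else 0) =
      (if True then f (Sum.inl j) else 0) + if j = i then f (Sum.inl j) else 0 := fun j => by
    rw [if_pos (by simp only [height, Sum.elim_inl, Sum.elim_inr]; omega), mult]
    by_cases h : j = i
    · simp [h]; ring
    · simp [h]
  have e2 : ∀ j : Fin n, (if height (Sum.inr i) < height (Sum.inr j) then
      mult (Sum.inr i) (Sum.inr j) * f (Sum.inr j) else 0) =
      if i.val < j.val then f (Sum.inr j) else 0 := fun j => by
    refine if_congr ?_ (by simp [mult]) rfl
    simp [height]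
  rw [Finset.sum_congr rfl fun j _ => e1 j, Finset.sum_congr rfl fun j _ => e2 j,
    Finset.sum_add_distrib, sum_ite_eq_sum_extendZero (fun j => f (Sum.inl j)) (fun _ => True),
    sum_ite_eq_sum_extendZero (fun j => f (Sum.inr j)) (fun j => i.val < j), extendZero_val,
    Finset.sum_ite_eq', if_pos (Finset.mem_univ i), Finset.filter_true_of_mem (fun _ _ => trivial)]
  congr 1
  refine Finset.sum_congr ?_ fun _ _ => rfl
  ext j
  simp only [Finset.mem_filter, Finset.mem_range, Finset.mem_Ico]; omega

end Conversion

/-! ### Nonvanishing of the leading coefficients. -/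

section Norms

variable {n : ℕ} {M : Type*} [AddCommGroup M] [Module ℂ M] [LieRingModule (𝔤 n) M]
  [LieModule ℂ (𝔤 n) M]

/-- The resolvent coefficient at `z = cas μ k`. -/
def resolvCoeff (μ : Wt n) (v : M) (φ : M →ₗ[ℂ] ℂ) (k a : Fin n ⊕ Fin n) : ℂ :=
  ∑ l, leadCoeff μ v φ a l / (cas μ k - cas μ l)

theorem sum_resolvCoeff {μ : Wt n} {v : M} {φ : M →ₗ[ℂ] ℂ} (h : IsSimpleHighestWeight μ v φ)
    (k j : Fin n ⊕ Fin n) :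
    ∑ a with height j < height a, mult j a * resolvCoeff μ v φ k a =
      ∑ l, (cas μ l - cas μ j) * leadCoeff μ v φ j l / (cas μ k - cas μ l) := by
  simp only [resolvCoeff, Finset.mul_sum]
  rw [Finset.sum_comm]
  refine Finset.sum_congr rfl fun l _ => ?_
  rw [leadCoeff_rec h, Finset.sum_div]
  exact Finset.sum_congr rfl fun a _ => by rw [mul_div_assoc]

/-- Partial fractions: `cas μ k - cas μ j` is the sum of `cas μ k - cas μ l` and `cas μ l - cas μ
j`. The first part sums to `φ v` and the second is the recursion of the leading coefficients. -/
theorem resolvCoeff_rec {μ : Wt n} {v : M} {φ : M →ₗ[ℂ] ℂ} (h : IsSimpleHighestWeight μ v φ)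
    (hn : 0 < n) (hy : Function.Injective (cas μ)) {k j : Fin n ⊕ Fin n}
    (hkj : height k < height j) :
    (cas μ k - cas μ j) * resolvCoeff μ v φ k j =
      φ v + ∑ a with height j < height a, mult j a * resolvCoeff μ v φ k a := by
  rw [sum_resolvCoeff h, ← sum_leadCoeff hn hy j, ← Finset.sum_add_distrib, resolvCoeff,
    Finset.mul_sum]
  refine Finset.sum_congr rfl fun l _ => ?_
  -- The term `l = k` of the resolvent has denominator zero, hence value `0`; this is harmless
  -- because the leading coefficient in it vanishes for `j` above `k`.
  by_cases hl : l = k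
  · subst hl
    rw [leadCoeff_eq_zero h hy hkj]; simp
  · have : cas μ k - cas μ l ≠ 0 := sub_ne_zero.2 fun e => hl (hy e).symm
    field_simp; ring

/-- For `l ≠ k` the two contributions cancel. For `l = k` the resolvent contributes `0`, so only the
diagonal coefficient survives. -/
theorem leadCoeff_self {μ : Wt n} {v : M} {φ : M →ₗ[ℂ] ℂ} (h : IsSimpleHighestWeight μ v φ)
    (hn : 0 < n) (hy : Function.Injective (cas μ)) (k : Fin n ⊕ Fin n) :
    leadCoeff μ v φ k k =
      φ v + ∑ a with height k < height a, mult k a * resolvCoeff μ v φ k a := by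
  rw [sum_resolvCoeff h, ← sum_leadCoeff hn hy k, ← Finset.sum_add_distrib,
    Finset.sum_eq_single k]
  · simp
  · intro l _ hl
    have : cas μ k - cas μ l ≠ 0 := sub_ne_zero.2 fun e => hl (hy e).symm
    field_simp; ring
  · simp

theorem leadCoeff_inl_ne_zero_iff {μ : Wt n} {v : M} {φ : M →ₗ[ℂ] ℂ}
    (h : IsSimpleHighestWeight μ v φ) (hy : Function.Injective (cas μ)) (i : Fin n) :
    leadCoeff μ v φ (Sum.inl i) (Sum.inl i) ≠ 0 ↔
      ∀ j < i, cas μ (Sum.inl i) + 1 ≠ cas μ (Sum.inl j) := by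
  have hn : 0 < n := i.pos
  rw [leadCoeff_self h hn hy, sum_higher_inl, partial_sum_ne_zero_iff
    (X := extendZero fun j => cas μ (Sum.inl j)) (z := cas μ (Sum.inl i)) h.ne_zero]
  · constructor
    · intro H j hj
      simpa [extendZero_val] using H j hj
    · intro H j hj
      have := H ⟨j, hj.trans i.2⟩ hj
      rwa [← extendZero_val (fun j => cas μ (Sum.inl j)) ⟨j, _⟩] at this
  · intro j hj
    obtain ⟨j, rfl⟩ : ∃ j' : Fin n, j = j' := ⟨⟨j, hj.trans i.2⟩, rfl⟩
    rw [extendZero_val, extendZero_val, resolvCoeff_rec h hn hy, sum_higher_inl]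
    simp only [height, Sum.elim_inl]; omega
  · intro j hj
    obtain ⟨j, rfl⟩ : ∃ j' : Fin n, j = j' := ⟨⟨j, hj.trans i.2⟩, rfl⟩
    rw [extendZero_val]
    intro e
    have := hy e
    simp at this
    omega

theorem leadCoeff_inr_ne_zero_iff {μ : Wt n} {v : M} {φ : M →ₗ[ℂ] ℂ}
    (h : IsSimpleHighestWeight μ v φ) (hy : Function.Injective (cas μ)) (i : Fin n)
    (h1 : cas μ (Sum.inl i) ≠ 1) (h2 : i.val + 1 < n → 2 * cas μ (Sum.inl i) ≠ 1) :
    leadCoeff μ v φ (Sum.inr i) (Sum.inr i) ≠ 0 ↔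
      (∀ j ≠ i, cas μ (Sum.inl i) + cas μ (Sum.inl j) ≠ 1) ∧
      (∀ j, i < j → cas μ (Sum.inl i) - 1 ≠ cas μ (Sum.inl j)) := by
  have hn : 0 < n := i.pos
  have hsw : ∀ j : Fin n, cas μ (Sum.inr j) = - cas μ (Sum.inl j) := fun j => cas_swap μ (Sum.inl j)
  set X := extendZero fun j => cas μ (Sum.inl j) with hX
  have hXi : ∀ j : Fin n, X j = cas μ (Sum.inl j) := fun j => extendZero_val _ j
  rw [lead_ne_zero_iff (X := X) (i := i) (n := n) h.ne_zero i.2 (B := extendZero fun j =>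
    resolvCoeff μ v φ (Sum.inr i) (Sum.inl j)) (B' := extendZero fun j =>
    resolvCoeff μ v φ (Sum.inr i) (Sum.inr j))]
  · refine and_congr ⟨fun H j hji => ?_, fun H j hj hji => ?_⟩
      ⟨fun H j hji => ?_, fun H j hj hji => ?_⟩
    · simpa [hXi] using H j j.2 (fun e => hji (Fin.ext e))
    · obtain ⟨j, rfl⟩ : ∃ j' : Fin n, j = j' := ⟨⟨j, hj⟩, rfl⟩
      rw [hXi, hXi]
      exact H j (fun e => hji (congrArg Fin.val e))
    · simpa [hXi] using H j j.2 hji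
    · obtain ⟨j, rfl⟩ : ∃ j' : Fin n, j = j' := ⟨⟨j, hj⟩, rfl⟩
      rw [hXi, hXi]
      exact H j hji
  · intro j hj
    obtain ⟨j, rfl⟩ : ∃ j' : Fin n, j = j' := ⟨⟨j, hj⟩, rfl⟩
    rw [hXi, hXi, extendZero_val, ← hsw, resolvCoeff_rec h hn hy, sum_higher_inl]
    simp only [height, Sum.elim_inl, Sum.elim_inr]; omega
  · intro j hj hij
    obtain ⟨j, rfl⟩ : ∃ j' : Fin n, j = j' := ⟨⟨j, hj⟩, rfl⟩
    have := resolvCoeff_rec h hn hy (k := Sum.inr i) (j := Sum.inr j)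
      (by simp only [height, Sum.elim_inr]; omega)
    rw [sum_higher_inr, hsw j] at this
    rw [hXi, hXi, extendZero_val _ j, ← hsw]
    linear_combination this
  · rw [leadCoeff_self h hn hy, sum_higher_inr]; ring
  · intro j hj
    obtain ⟨j, rfl⟩ : ∃ j' : Fin n, j = j' := ⟨⟨j, hj⟩, rfl⟩
    rw [hXi, hXi, ← hsw]
    intro e
    have := hy e
    simp at this
  · intro j hj hij
    obtain ⟨j, rfl⟩ : ∃ j' : Fin n, j = j' := ⟨⟨j, hj⟩, rfl⟩
    rw [hXi, hXi, ← hsw]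
    intro e
    have : cas μ (Sum.inr i) = cas μ (Sum.inr j) := by rw [hsw j]; linear_combination e
    have := hy this
    simp at this
    omega
  · rwa [hXi]
  · rwa [hXi]

end Norms

/-! ### The set `A` as type `D` regularity. -/

section Weights

variable {n : ℕ}

theorem wt_ext {μ ν : Wt n} (h : ∀ i : Fin n, μ (cartanElt (Sum.inl i)) = ν (cartanElt (Sum.inl i))) :
    μ = ν := by
  have h' : ∀ k : Fin n ⊕ Fin n, μ (cartanElt k) = ν (cartanElt k) := by
    rintro (i | i)
    · exact h i
    · rw [show (Sum.inr i : Fin n ⊕ Fin n) = (Sum.inl i).swap from rfl, cartanElt_swap, map_neg,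
        map_neg, h]
  ext H
  rw [cartan_eq_sum H]
  simp only [map_sum, map_smul, h']

theorem ε_cartanElt (i j : Fin n) :
    ε i (cartanElt (Sum.inl j)) = if i = j then 1 else 0 := by
  have := wt_cartanElt (Sum.inl j) (Sum.inl i)
  simpa [wt] using this

/-- The weight `λ` with `λ + ρ` having the coordinates `b_j - 1/2`. -/
def wtOf (b : Fin n → ℤ) : Wt n := ∑ j : Fin n, ((b j : ℂ) - n + j - 1 / 2) • ε j

theorem wtOf_cartanElt (b : Fin n → ℤ) (j : Fin n) :
    wtOf b (cartanElt (Sum.inl j)) = (b j : ℂ) - n + j - 1 / 2 := by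
  simp [wtOf, LinearMap.sum_apply, ε_cartanElt]

theorem cas_wtOf_inl (b : Fin n → ℤ) (j : Fin n) : cas (wtOf b) (Sum.inl j) = b j - 1 / 2 := by
  rw [cas, wtOf_cartanElt]
  simp only [height, Sum.elim_inl]; push_cast; ring

theorem cas_wtOf_inr (b : Fin n → ℤ) (j : Fin n) : cas (wtOf b) (Sum.inr j) = 1 / 2 - b j := by
  rw [show (Sum.inr j : Fin n ⊕ Fin n) = (Sum.inl j).swap from rfl, cas_swap, cas_wtOf_inl]; ring

theorem wtOf_injective : Function.Injective (wtOf (n := n)) := by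
  intro b b' h
  funext j
  have h1 := cas_wtOf_inl b j
  rw [h, cas_wtOf_inl] at h1
  have : (b j : ℂ) = b' j := by linear_combination -h1
  exact_mod_cast this

/-- Dominance and regularity of the half-integral weight with coordinates `b_j - 1/2` for the root
system of type `D`. -/
def IsDRegular (b : Fin n → ℤ) : Prop := ∀ i j, i < j → b j < b i ∧ 2 ≤ b i + b j

theorem wt_injective : Function.Injective (wt (n := n)) := by
  intro k j h
  apply height_injective
  have := congrArg (fun f : Wt n => f (gradingElt n)) h
  simp only [wt_gradingElt] at this
  exact_mod_cast this

/-- A coincidence of eigenvalues means `b i = b j` or `b i + b j = 1`. Regularity excludes both for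
`i ≠ j`, and parity excludes the second for `i = j`. -/
theorem IsDRegular.cas_injective {b : Fin n → ℤ} (hb : IsDRegular b) :
    Function.Injective (cas (wtOf b)) := by
  have h1 : ∀ i j, b i = b j → i = j := by
    intro i j h
    rcases lt_trichotomy i j with h' | h' | h'
    · have := (hb i j h').1; omega
    · exact h'
    · have := (hb j i h').1; omega
  have h2 : ∀ i j, b i + b j ≠ 1 := by
    intro i j h
    rcases lt_trichotomy i j with h' | h' | h'
    · have := (hb i j h').2; omega
    · subst h'; omega
    · have := (hb j i h').2; omega
  rintro (i | i) (j | j) h <;> simp only [cas_wtOf_inl, cas_wtOf_inr] at h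
  · have : (b i : ℂ) = b j := by linear_combination h
    rw [h1 i j (by exact_mod_cast this)]
  · have : (b i : ℂ) + b j = 1 := by linear_combination h
    exact absurd (by exact_mod_cast this) (h2 i j)
  · have : (b i : ℂ) + b j = 1 := by linear_combination -h
    exact absurd (by exact_mod_cast this) (h2 i j)
  · have : (b i : ℂ) = b j := by linear_combination -h
    rw [h1 i j (by exact_mod_cast this)]

/-- The shift of coordinates corresponding to adding the weight of a basis vector. -/
def shift (b : Fin n → ℤ) : Fin n ⊕ Fin n → Fin n → ℤ :=
  Sum.elim (fun i => b + Pi.single i 1) (fun i => b - Pi.single i 1)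

theorem wtOf_shift (b : Fin n → ℤ) (k : Fin n ⊕ Fin n) : wtOf (shift b k) = wtOf b + wt k := by
  refine wt_ext fun j => ?_
  rw [LinearMap.add_apply, wtOf_cartanElt, wtOf_cartanElt, wt_cartanElt]
  rcases k with k | k
  · by_cases h : j = k
    · subst h; simp [shift]; ring
    · simp [shift, h, Ne.symm h]
  · by_cases h : j = k
    · subst h; simp [shift]; ring
    · simp [shift, h, Ne.symm h]

theorem isDRegular_shift_inl {b : Fin n → ℤ} (hb : IsDRegular b) (i : Fin n) :
    IsDRegular (shift b (Sum.inl i)) ↔ ∀ j < i, b i + 1 ≠ b j := by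
  simp only [IsDRegular, shift, Sum.elim_inl, Pi.add_apply, Pi.single_apply]
  constructor
  · intro h j hj
    have := h j i hj
    simp only [hj.ne, if_false, if_true] at this
    omega
  · intro h p q hpq
    have h1 := hb p q hpq
    by_cases hq : q = i
    · subst hq
      have := h p hpq
      simp only [hpq.ne, if_false, if_true]
      omega
    · simp only [hq, if_false]
      split_ifs <;> omega

theorem isDRegular_shift_inr {b : Fin n → ℤ} (hb : IsDRegular b) (i : Fin n) :
    IsDRegular (shift b (Sum.inr i)) ↔
      (∀ j ≠ i, b i + b j ≠ 2) ∧ (∀ j, i < j → b i - 1 ≠ b j) := by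
  simp only [IsDRegular, shift, Sum.elim_inr, Pi.sub_apply, Pi.single_apply]
  constructor
  · intro h
    refine ⟨fun j hj => ?_, fun j hj => ?_⟩
    · rcases lt_or_gt_of_ne hj with h' | h'
      · have := h j i h'
        simp only [h'.ne, if_false, if_true] at this
        omega
      · have := h i j h'
        simp only [h'.ne', if_false, if_true] at this
        omega
    · have := h i j hj
      simp only [hj.ne', if_false, if_true] at this
      omega
  · rintro ⟨h, h'⟩ p q hpq
    have h1 := hb p q hpq
    by_cases hq : q = i
    · subst hq
      have := h p hpq.ne
      simp only [hpq.ne, if_false, if_true]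
      omega
    · simp only [hq, if_false]
      split_ifs with hp
      · subst hp
        have := h q hq
        have := h' q hpq
        omega
      · omega

/-- The excluded values of the lower case do not occur: eigenvalue `1` is not half-odd, and
eigenvalue `1/2` means `b i = 1`, which regularity forbids unless `i` is last. -/
theorem leadCoeff_ne_zero_iff {M : Type*} [AddCommGroup M] [Module ℂ M] [LieRingModule (𝔤 n) M]
    [LieModule ℂ (𝔤 n) M] {b : Fin n → ℤ} (hb : IsDRegular b) {v : M} {φ : M →ₗ[ℂ] ℂ}
    (h : IsSimpleHighestWeight (wtOf b) v φ) (k : Fin n ⊕ Fin n) :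
    leadCoeff (wtOf b) v φ k k ≠ 0 ↔ IsDRegular (shift b k) := by
  rcases k with i | i
  · rw [leadCoeff_inl_ne_zero_iff h hb.cas_injective, isDRegular_shift_inl hb]
    refine forall_congr' fun j => forall_congr' fun hj => not_congr ?_
    rw [cas_wtOf_inl, cas_wtOf_inl]
    constructor
    · intro e
      have : (b i : ℂ) + 1 = b j := by linear_combination e
      exact_mod_cast this
    · intro e
      rw [← e]; push_cast; ring
  · rw [leadCoeff_inr_ne_zero_iff h hb.cas_injective, isDRegular_shift_inr hb]
    · refine and_congr (forall_congr' fun j => forall_congr' fun hj => not_congr ?_)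
        (forall_congr' fun j => forall_congr' fun hj => not_congr ?_)
      · rw [cas_wtOf_inl, cas_wtOf_inl]
        constructor
        · intro e
          have : (b i : ℂ) + b j = 2 := by linear_combination e
          exact_mod_cast this
        · intro e
          have : (b i : ℂ) + b j = 2 := by exact_mod_cast e
          linear_combination this
      · rw [cas_wtOf_inl, cas_wtOf_inl]
        constructor
        · intro e
          have : (b i : ℂ) - 1 = b j := by linear_combination e
          exact_mod_cast this
        · intro e
          rw [← e]; push_cast; ring
    · rw [cas_wtOf_inl]
      intro e
      have : (2 : ℂ) * b i = 3 := by linear_combination 2 * e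
      have : 2 * b i = 3 := by exact_mod_cast this
      omega
    · rw [cas_wtOf_inl]
      intro hi e
      have h1 : (2 : ℂ) * b i = 2 := by linear_combination e
      have h2 : 2 * b i = 2 := by exact_mod_cast h1
      have := hb i ⟨i + 1, hi⟩ (Fin.lt_def.2 (Nat.lt_succ_self _))
      omega

theorem sum_ϖ_cartanElt (c : ℕ → ℝ) (j : Fin n) :
    (∑ i ∈ Finset.Icc 1 n, (c i : ℂ) • ϖ n i) (cartanElt (Sum.inl j)) =
      ∑ i ∈ Finset.Ico (j.val + 1) n, (c i : ℂ) + c n := by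
  have h1 : ∀ i, ϖ n i (cartanElt (Sum.inl j)) = if j.val < i then 1 else 0 := by
    intro i
    rw [ϖ, LinearMap.sum_apply]
    simp only [ε_cartanElt, Finset.sum_ite_eq', Finset.mem_filter, Finset.mem_univ, true_and]
  rw [LinearMap.sum_apply]
  simp only [LinearMap.smul_apply, h1, smul_eq_mul, mul_ite, mul_one, mul_zero]
  rw [← Finset.sum_filter]
  have hj := j.2
  rw [← Finset.sum_Ico_succ_top (by omega : j.val + 1 ≤ n)]
  refine Finset.sum_congr ?_ fun _ _ => rfl
  ext i
  simp only [Finset.mem_filter, Finset.mem_Icc, Finset.mem_Ico]; omega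

theorem exists_of_mem_A (hn : 2 ≤ n) {μ : Wt n} (hμ : μ ∈ A n) :
    ∃ b : Fin n → ℤ, IsDRegular b ∧ μ = wtOf b := by
  obtain ⟨c, rfl, hc, ⟨k, hk⟩, hpos⟩ := hμ
  choose! d hd using hc
  let s : ℕ → ℤ := fun j => ∑ i ∈ Finset.Ico (j + 1) n, (d i : ℤ)
  have hs : ∀ i j, i ≤ j → s j ≤ s i := by
    intro i j hij
    refine Finset.sum_le_sum_of_subset_of_nonneg ?_ fun _ _ _ => Int.natCast_nonneg _
    exact Finset.Ico_subset_Ico_left (by omega)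
  have hs1 : s (n - 1) = 0 := by
    simp only [s]; rw [Finset.Ico_eq_empty (by omega), Finset.sum_empty]
  have hs2 : s (n - 2) = d (n - 1) := by
    simp only [s]
    rw [show n - 2 + 1 = n - 1 by omega, Finset.sum_eq_sum_Ico_succ_bot (by omega),
      Finset.Ico_eq_empty (by omega), Finset.sum_empty, add_zero]
  have hpos' : 0 < (d (n - 1) : ℤ) + 2 * k + 4 := by
    rw [hd (n - 1) (Finset.mem_Icc.2 ⟨by omega, le_rfl⟩), hk] at hpos
    have : (0 : ℝ) < (((d (n - 1) : ℤ) + 2 * k + 4 : ℤ) : ℝ) := by push_cast; linarith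
    exact_mod_cast this
  -- The coordinate of the weight is `s j + k + 1/2`; adding `n - j` from `ρ` and `1/2` gives `b j`.
  -- The last inequality in `A` becomes `2 ≤ b i + b j` for the last two indices, the smallest such
  -- sum.
  refine ⟨fun j => s j + k + 1 + n - j, fun i j hij => ?_, wt_ext fun j => ?_⟩
  · have hij' := Fin.lt_def.1 hij
    have h1 := hs i j hij'.le
    have h2 := hs j (n - 1) (by omega)
    have h3 := hs i (n - 2) (by omega)
    have := j.2
    constructor <;> simp only <;> omega
  · rw [sum_ϖ_cartanElt, wtOf_cartanElt, hk]
    have h1 : ∑ i ∈ Finset.Ico (j.val + 1) n, (c i : ℂ) = (s j : ℂ) := by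
      simp only [s]; push_cast
      refine Finset.sum_congr rfl fun i hi => ?_
      rw [Finset.mem_Ico] at hi
      rw [hd i (Finset.mem_Icc.2 ⟨by omega, by omega⟩)]
      push_cast; rfl
    rw [h1]
    push_cast; ring

theorem wtOf_mem_A (hn : 2 ≤ n) {b : Fin n → ℤ} (hb : IsDRegular b) : wtOf b ∈ A n := by
  let β : ℕ → ℤ := fun i => if h : i < n then b ⟨i, h⟩ else 0
  have hβ : ∀ i (h : i < n), β i = b ⟨i, h⟩ := fun i h => dif_pos h
  have hreg : ∀ i j, i < j → j < n → β j < β i ∧ 2 ≤ β i + β j := by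
    intro i j hij hj
    rw [hβ j hj, hβ i (by omega)]
    exact hb _ _ (Fin.lt_def.2 hij)
  -- Differences of consecutive coordinates of the weight; since indices in `β` start at `0`, the
  -- coefficient of `ϖ_i` uses `β (i - 1)` and `β i`.
  let c : ℕ → ℝ := fun i => if i = n then (β (n - 1) : ℝ) - 3 / 2 else (β (i - 1) : ℝ) - β i - 1
  have hcn : c n = (β (n - 1) : ℝ) - 3 / 2 := if_pos rfl
  have hci : ∀ i, i < n → c i = (β (i - 1) : ℝ) - β i - 1 := fun i hi => if_neg hi.ne
  refine ⟨c, wt_ext fun j => ?_, fun i hi => ?_, ⟨β (n - 1) - 2, ?_⟩, ?_⟩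
  · rw [sum_ϖ_cartanElt, wtOf_cartanElt, hcn]
    have h1 : ∀ d, d < n → ∑ i ∈ Finset.Ico (n - 1 - d + 1) n, (c i : ℂ) =
        (β (n - 1 - d) : ℂ) - β (n - 1) - d := by
      intro d hd
      induction d with
      | zero => rw [Finset.Ico_eq_empty (by omega)]; simp
      | succ d ih =>
        rw [Finset.sum_eq_sum_Ico_succ_bot (by omega),
          show n - 1 - (d + 1) + 1 = n - 1 - d by omega, ih (by omega), hci _ (by omega),
          show n - 1 - d - 1 = n - 1 - (d + 1) by omega]
        push_cast; ring
    have h2 := h1 (n - 1 - j) (by omega)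
    have hj := j.2
    rw [show n - 1 - (n - 1 - j.val) = j.val by omega, hβ j hj, Nat.sub_sub,
      Nat.cast_sub (by omega)] at h2
    rw [h2]
    push_cast; ring
  · rw [Finset.mem_Icc] at hi
    have h1 := (hreg (i - 1) i (by omega) (by omega)).1
    obtain ⟨m, hm⟩ := Int.eq_ofNat_of_zero_le (a := β (i - 1) - β i - 1) (by omega)
    refine ⟨m, ?_⟩
    rw [hci i (by omega)]
    have : ((β (i - 1) - β i - 1 : ℤ) : ℝ) = (m : ℤ) := by rw [hm]
    push_cast at this
    exact this
  · rw [hcn]; push_cast; ring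
  · rw [hcn, hci (n - 1) (by omega)]
    have h1 := (hreg (n - 1 - 1) (n - 1) (by omega) (by omega)).2
    have h2 : (2 : ℝ) ≤ β (n - 1 - 1) + β (n - 1) := by exact_mod_cast h1
    linarith

theorem wtOf_mem_A_iff (hn : 2 ≤ n) {b : Fin n → ℤ} : wtOf b ∈ A n ↔ IsDRegular b := by
  refine ⟨fun h => ?_, wtOf_mem_A hn⟩
  obtain ⟨b', hb', he⟩ := exists_of_mem_A hn h
  rwa [wtOf_injective he]

theorem mem_Aof_iff (hn : 2 ≤ n) {b : Fin n → ℤ} {lam : Wt n} :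
    lam ∈ Aof (wtOf b) ↔ ∃ k, lam = wtOf b + wt k ∧ IsDRegular (shift b k) := by
  constructor
  · rintro ⟨hA, i, rfl | rfl⟩
    · refine ⟨Sum.inl i, rfl, ?_⟩
      rw [← wtOf_mem_A_iff hn, wtOf_shift]; exact hA
    · refine ⟨Sum.inr i, sub_eq_add_neg _ _, ?_⟩
      rw [← wtOf_mem_A_iff hn, wtOf_shift, wt, Sum.elim_inr, ← sub_eq_add_neg]; exact hA
  · rintro ⟨k, rfl, hk⟩
    refine ⟨by rw [← wtOf_shift]; exact wtOf_mem_A hn hk, ?_⟩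
    rcases k with i | i
    · exact ⟨i, Or.inl rfl⟩
    · exact ⟨i, Or.inr (sub_eq_add_neg _ _).symm⟩

end Weights

/-! ### Quadratic elements of the Weyl algebra. -/

section Weyl

variable {n : ℕ} {R : Type*} [Ring R] [Algebra ℂ R]

/-- The quadratic element of the Weyl algebra attached to a symplectic matrix. -/
def quadratic (a : Fin n ⊕ Fin n → R) (Z : 𝔤 n) : R :=
  ∑ k, ∑ l, (-(1 / 2) * (Z : Matrix _ _ ℂ) k l * sgn l) • (a k * a l.swap)

theorem quadratic_add (a : Fin n ⊕ Fin n → R) (Z Y : 𝔤 n) :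
    quadratic a (Z + Y) = quadratic a Z + quadratic a Y := by
  simp only [quadratic, ← Finset.sum_add_distrib, ← add_smul]
  refine Finset.sum_congr rfl fun k _ => Finset.sum_congr rfl fun l _ => ?_
  congr 1
  simp only [AddMemClass.coe_add, Matrix.add_apply]; ring

theorem quadratic_smul (a : Fin n ⊕ Fin n → R) (c : ℂ) (Z : 𝔤 n) :
    quadratic a (c • Z) = c • quadratic a Z := by
  simp only [quadratic, Finset.smul_sum, smul_smul]
  refine Finset.sum_congr rfl fun k _ => Finset.sum_congr rfl fun l _ => ?_
  congr 1
  simp only [SetLike.val_smul, Matrix.smul_apply, smul_eq_mul]; ring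

theorem sum_swap {A : Type*} [AddCommMonoid A] (f : Fin n ⊕ Fin n → A) :
    ∑ k : Fin n ⊕ Fin n, f k.swap = ∑ k, f k :=
  Equiv.sum_comp (Equiv.sumComm (Fin n) (Fin n)) f

theorem mul_quadratic (a : Fin n ⊕ Fin n → R) (Z : 𝔤 n) (x : R) :
    x * quadratic a Z = ∑ k, ∑ l,
      (-(1 / 2) * (Z : Matrix _ _ ℂ) k l * sgn l) • (x * (a k * a l.swap)) := by
  simp only [quadratic, Finset.mul_sum, mul_smul_comm]

theorem quadratic_mul (a : Fin n ⊕ Fin n → R) (Z : 𝔤 n) (x : R) :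
    quadratic a Z * x = ∑ k, ∑ l,
      (-(1 / 2) * (Z : Matrix _ _ ℂ) k l * sgn l) • (a k * a l.swap * x) := by
  simp only [quadratic, Finset.sum_mul, smul_mul_assoc]

/-- Commutation with `quadratic a Z` is the defining representation on the span of the generators;
the factor `1/2` compensates for the two equal contributions. -/
theorem quadratic_mul_sub {a : Fin n ⊕ Fin n → R}
    (ha : ∀ k l, a k * a l = a l * a k + (if l = k.swap then sgn k else 0) • (1 : R))
    (Z : 𝔤 n) (m : Fin n ⊕ Fin n) :
    quadratic a Z * a m - a m * quadratic a Z = ∑ k, (Z : Matrix _ _ ℂ) k m • a k := by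
  have h1 : ∀ k l : Fin n ⊕ Fin n, a k * a l.swap * a m - a m * (a k * a l.swap) =
      (if m = l then - sgn l else 0) • a k + (if m = k.swap then sgn k else 0) • a l.swap := by
    intro k l
    have e1 := ha l.swap m
    have e2 := ha k m
    rw [Sum.swap_swap, sgn_swap] at e1
    rw [mul_assoc, e1, ← mul_assoc, mul_add, ← mul_assoc, e2, add_mul, mul_smul_comm, smul_mul_assoc,
      mul_one, one_mul, mul_assoc]
    abel
  have h2 : ∀ k : Fin n ⊕ Fin n, (m = k.swap) = (k = m.swap) := by
    intro l; apply propext; constructor <;> (rintro rfl; simp)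
  simp only [quadratic_mul, mul_quadratic, ← Finset.sum_sub_distrib, ← smul_sub, h1, smul_add,
    smul_smul, Finset.sum_add_distrib]
  simp only [h2, mul_ite, mul_zero, ite_smul, zero_smul]
  rw [Finset.sum_comm (f := fun k l => if k = m.swap then _ else (0 : R))]
  simp only [Finset.sum_ite_eq, Finset.sum_ite_eq', Finset.mem_univ, if_true]
  rw [← sum_swap, ← Finset.sum_add_distrib, ← sum_swap]
  refine Finset.sum_congr rfl fun k _ => ?_
  simp only [Sum.swap_swap]
  rw [← add_smul]
  congr 1
  rw [sp_apply_swap, sgn_swap, sgn_swap]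
  linear_combination (1 / 2 : ℂ) * (Z : Matrix _ _ ℂ) k m *
    (sgn m * sgn m * sgn_mul_self k + 2 * sgn_mul_self m)

theorem sum_triple_comm {ι A : Type*} [Fintype ι] [AddCommMonoid A] (f : ι → ι → ι → A) :
    ∑ k, ∑ l, ∑ m, f k l m = ∑ m, ∑ l, ∑ k, f k l m := by
  rw [Finset.sum_comm, Finset.sum_congr rfl fun l _ => Finset.sum_comm, Finset.sum_comm]

/-- Commutation with `quadratic a Z` is a derivation, known on generators, so its value on the
quadratic element of `Y` is a matrix commutator. -/
theorem quadratic_lie {a : Fin n ⊕ Fin n → R}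
    (ha : ∀ k l, a k * a l = a l * a k + (if l = k.swap then sgn k else 0) • (1 : R))
    (Z Y : 𝔤 n) :
    quadratic a Z * quadratic a Y - quadratic a Y * quadratic a Z = quadratic a ⁅Z, Y⁆ := by
  have h1 : ∀ k l : Fin n ⊕ Fin n, quadratic a Z * (a k * a l.swap) -
      a k * a l.swap * quadratic a Z = ∑ m, (Z : Matrix _ _ ℂ) m k • (a m * a l.swap) +
        ∑ m, (-(sgn m * sgn l) * (Z : Matrix _ _ ℂ) l m) • (a k * a m.swap) := by
    intro k l
    have e1 := quadratic_mul_sub ha Z k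
    have e2 := quadratic_mul_sub ha Z l.swap
    have e3 : quadratic a Z * (a k * a l.swap) - a k * a l.swap * quadratic a Z =
        (quadratic a Z * a k - a k * quadratic a Z) * a l.swap +
        a k * (quadratic a Z * a l.swap - a l.swap * quadratic a Z) := by noncomm_ring
    rw [e3, e1, e2, Finset.sum_mul, Finset.mul_sum]
    simp only [smul_mul_assoc, mul_smul_comm]
    congr 1
    rw [← sum_swap]
    refine Finset.sum_congr rfl fun m _ => ?_
    rw [sp_apply_swap]; congr 1; ring
  have h2 : quadratic a Z * quadratic a Y - quadratic a Y * quadratic a Z =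
      ∑ k, ∑ l, (-(1 / 2) * (Y : Matrix _ _ ℂ) k l * sgn l) •
        (quadratic a Z * (a k * a l.swap) - a k * a l.swap * quadratic a Z) := by
    rw [mul_quadratic a Y (quadratic a Z), quadratic_mul a Y (quadratic a Z)]
    generalize quadratic a Z = q
    simp only [smul_sub, Finset.sum_sub_distrib]
  rw [h2]
  simp only [h1, smul_add, Finset.sum_add_distrib, Finset.smul_sum, smul_smul]
  rw [sum_triple_comm (fun k l m : Fin n ⊕ Fin n =>
    (-(1 / 2) * (Y : Matrix (Fin n ⊕ Fin n) (Fin n ⊕ Fin n) ℂ) k l * sgn l *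
      (Z : Matrix (Fin n ⊕ Fin n) (Fin n ⊕ Fin n) ℂ) m k) • (a m * a l.swap)),
    quadratic, ← Finset.sum_add_distrib]
  refine Finset.sum_congr rfl fun k _ => ?_
  rw [Finset.sum_comm (f := fun l m : Fin n ⊕ Fin n =>
    (-(1 / 2) * (Y : Matrix (Fin n ⊕ Fin n) (Fin n ⊕ Fin n) ℂ) k l * sgn l * (-(sgn m * sgn l) *
      (Z : Matrix (Fin n ⊕ Fin n) (Fin n ⊕ Fin n) ℂ) l m)) • (a k * a m.swap)),
    ← Finset.sum_add_distrib]
  refine Finset.sum_congr rfl fun l _ => ?_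
  rw [← Finset.sum_smul, ← Finset.sum_smul, ← add_smul]
  congr 1
  simp only [LieSubalgebra.coe_bracket, Ring.lie_def, Matrix.sub_apply, Matrix.mul_apply]
  rw [mul_sub, sub_mul, sub_eq_add_neg, Finset.mul_sum, Finset.mul_sum, Finset.sum_mul,
    Finset.sum_mul, ← Finset.sum_neg_distrib]
  congr 1
  · exact Finset.sum_congr rfl fun m _ => by ring
  · refine Finset.sum_congr rfl fun m _ => ?_
    linear_combination (1 / 2 : ℂ) * (Y : Matrix _ _ ℂ) k m * (Z : Matrix _ _ ℂ) m l * sgn l *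
      sgn_mul_self m

end Weyl

/-! ### The oscillator representation on polynomials. -/

section Oscillator

variable {n : ℕ}

/-- The space of polynomials, which carries the oscillator representation. -/
def Oscillator (n : ℕ) : Type := MvPolynomial (Fin n) ℂ

instance : AddCommGroup (Oscillator n) := inferInstanceAs (AddCommGroup (MvPolynomial (Fin n) ℂ))
instance : Module ℂ (Oscillator n) := inferInstanceAs (Module ℂ (MvPolynomial (Fin n) ℂ))

/-- Derivatives and multiplications by variables. -/
def weylOp : Fin n ⊕ Fin n → Module.End ℂ (MvPolynomial (Fin n) ℂ) :=
  Sum.elim (fun i => (MvPolynomial.pderiv i).toLinearMap)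
    (fun i => LinearMap.mulLeft ℂ (MvPolynomial.X i))

theorem weylOp_inl (i : Fin n) (p : MvPolynomial (Fin n) ℂ) :
    weylOp (Sum.inl i) p = MvPolynomial.pderiv i p := rfl

theorem weylOp_inr (i : Fin n) (p : MvPolynomial (Fin n) ℂ) :
    weylOp (Sum.inr i) p = MvPolynomial.X i * p := rfl

theorem weylOp_mul_comm (k l : Fin n ⊕ Fin n) :
    weylOp k * weylOp l = weylOp l * weylOp k +
      (if l = k.swap then sgn k else 0) • (1 : Module.End ℂ (MvPolynomial (Fin n) ℂ)) := by
  have hcomm : ∀ (i j : Fin n) (p : MvPolynomial (Fin n) ℂ),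
      MvPolynomial.pderiv i (MvPolynomial.pderiv j p) =
        MvPolynomial.pderiv j (MvPolynomial.pderiv i p) := by
    intro i j p
    have h : ⁅(MvPolynomial.pderiv i : Derivation ℂ (MvPolynomial (Fin n) ℂ)
        (MvPolynomial (Fin n) ℂ)), (MvPolynomial.pderiv j : Derivation ℂ (MvPolynomial (Fin n) ℂ)
        (MvPolynomial (Fin n) ℂ))⁆ = 0 := by
      refine MvPolynomial.derivation_ext (R := ℂ) (σ := Fin n) fun l => ?_
      rw [Derivation.commutator_apply]
      simp [MvPolynomial.pderiv_X, Pi.single_apply, apply_ite]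
    have h1 := congrArg (fun D : Derivation ℂ (MvPolynomial (Fin n) ℂ) _ => D p) h
    rw [Derivation.commutator_apply] at h1
    exact sub_eq_zero.1 h1
  refine LinearMap.ext fun p => ?_
  simp only [Module.End.mul_apply, LinearMap.add_apply, LinearMap.smul_apply, Module.End.one_apply]
  rcases k with i | i <;> rcases l with j | j <;> simp only [weylOp_inl, weylOp_inr]
  · simp [hcomm i j p]
  · by_cases h : j = i
    · subst h; simp [sgn, add_comm]
    · simp [MvPolynomial.pderiv_X_of_ne h, h]
  · by_cases h : j = i
    · subst h; simp [sgn]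
    · simp [MvPolynomial.pderiv_X_of_ne (Ne.symm h), h]
  · simp [mul_left_comm]

/-- Either the inner operator differentiates `1`, or the outer one differentiates a different
variable; two multiplications would have negative total height. -/
theorem weylOp_one {k l : Fin n ⊕ Fin n} (h : 0 < height k + height l) (hkl : l ≠ k.swap) :
    weylOp k (weylOp l (1 : MvPolynomial (Fin n) ℂ)) = 0 := by
  rcases l with j | j
  · rw [weylOp_inl, MvPolynomial.pderiv_one, map_zero]
  · rcases k with i | i
    · rw [weylOp_inl, weylOp_inr, mul_one]
      exact MvPolynomial.pderiv_X_of_ne fun e => hkl (by rw [e]; rfl)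
    · simp only [height, Sum.elim_inr] at h; omega

instance : LieRingModule (𝔤 n) (Oscillator n) where
  bracket Z p := quadratic weylOp Z p
  add_lie Z Y p := by
    change quadratic weylOp (Z + Y) p = quadratic weylOp Z p + quadratic weylOp Y p
    rw [quadratic_add]; rfl
  lie_add Z p q := map_add (quadratic weylOp Z) p q
  leibniz_lie Z Y p := by
    change quadratic weylOp Z (quadratic weylOp Y p) = quadratic weylOp ⁅Z, Y⁆ p +
      quadratic weylOp Y (quadratic weylOp Z p)
    rw [← quadratic_lie weylOp_mul_comm]
    exact (sub_add_cancel _ _).symm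

theorem oscillator_lie (Z : 𝔤 n) (p : Oscillator n) :
    ⁅Z, p⁆ = (quadratic weylOp Z : Module.End ℂ (MvPolynomial (Fin n) ℂ)) p := rfl

instance : LieModule ℂ (𝔤 n) (Oscillator n) where
  smul_lie c Z p := by rw [oscillator_lie, quadratic_smul]; rfl
  lie_smul c Z p := map_smul (quadratic weylOp Z) c p

/-- The weight is `-1/2` in every coordinate: on the constant `1` only the orderings `∂_i x_i`
survive, each with coefficient `-1/2`. -/
theorem isSingular_oscillator :
    IsSingular (wtOf fun j : Fin n => (n : ℤ) - j) (1 : MvPolynomial (Fin n) ℂ) (M := Oscillator n) where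
  raise k j h := by
    change (quadratic weylOp (elt k j)) (1 : MvPolynomial (Fin n) ℂ) = 0
    simp only [quadratic, LinearMap.sum_apply, LinearMap.smul_apply, Module.End.mul_apply]
    refine Finset.sum_eq_zero fun a _ => Finset.sum_eq_zero fun b _ => ?_
    rw [elt_apply]
    by_cases h1 : a = k ∧ b = j
    · obtain ⟨rfl, rfl⟩ := h1
      rw [weylOp_one, smul_zero]
      · rw [height_swap]; omega
      · intro e; rw [← height_injective.eq_iff, height_swap, height_swap] at e; omega
    · by_cases h2 : a = j.swap ∧ b = k.swap
      · obtain ⟨rfl, rfl⟩ := h2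
        rw [weylOp_one, smul_zero]
        · rw [height_swap, Sum.swap_swap]; omega
        · intro e; rw [Sum.swap_swap, Sum.swap_swap] at e; subst e; omega
      · simp only [← ite_and, h1, h2, if_false]
        simp
  weight H := by
    have hd : ((H : 𝔤 n) : Matrix (Fin n ⊕ Fin n) (Fin n ⊕ Fin n) ℂ).IsDiag := H.2
    change (quadratic weylOp (H : 𝔤 n)) (1 : MvPolynomial (Fin n) ℂ) =
      _ • (1 : MvPolynomial (Fin n) ℂ)
    simp only [quadratic, LinearMap.sum_apply, LinearMap.smul_apply, Module.End.mul_apply]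
    have h1 : ∀ k, ∑ l, (-(1 / 2) * ((H : 𝔤 n) : Matrix _ _ ℂ) k l * sgn l) •
        weylOp k (weylOp l.swap (1 : MvPolynomial (Fin n) ℂ)) =
        (-(1 / 2) * wt k H * sgn k) • weylOp k (weylOp k.swap (1 : MvPolynomial (Fin n) ℂ)) := by
      intro k
      rw [Finset.sum_eq_single k, wt_apply]
      · intro b _ hb; rw [hd hb.symm]; simp
      · simp
    rw [Finset.sum_congr rfl fun k _ => h1 k, Fintype.sum_sum_type]
    simp only [Sum.swap_inl, Sum.swap_inr, weylOp_inl, weylOp_inr]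
    simp only [mul_one, MvPolynomial.pderiv_X_self, MvPolynomial.pderiv_one, mul_zero, smul_zero,
      Finset.sum_const_zero, add_zero]
    rw [← Finset.sum_smul]
    congr 1
    rw [wtOf, LinearMap.sum_apply]
    refine Finset.sum_congr rfl fun i _ => ?_
    simp only [sgn, wt, Sum.elim_inl, LinearMap.smul_apply, smul_eq_mul]
    push_cast; ring

end Oscillator

/-! ### Properness of the Verma ideals for all weights in `A`. -/

section Existence

variable {n : ℕ}

theorem vermaIdeal_ne_top_shift {b : Fin n → ℤ} (hb : IsDRegular b) (k : Fin n ⊕ Fin n)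
    (hk : IsDRegular (shift b k)) (h : vermaIdeal (wtOf b) ≠ ⊤) :
    vermaIdeal (wtOf (shift b k)) ≠ ⊤ := by
  obtain ⟨v, φ, hvφ⟩ := exists_isSimpleHighestWeight_L h
  have h1 := isSimpleHighestWeight_casSpace hvφ hb.cas_injective k
    ((leadCoeff_ne_zero_iff hb hvφ k).2 hk)
  rw [wtOf_shift]
  exact vermaIdeal_ne_top h1.singular fun e => h1.ne_zero (by rw [e, map_zero])

theorem shift_swap (b : Fin n → ℤ) (k : Fin n ⊕ Fin n) : shift (shift b k) k.swap = b := by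
  rcases k with i | i <;> simp [shift]

/-- Two regular weights are connected through regular weights by adding weights of `ℂ²ⁿ`. -/
theorem IsDRegular.exists_shift {b : Fin n → ℤ} (hb : IsDRegular b)
    (hne : b ≠ fun j : Fin n => (n : ℤ) - j) :
    ∃ k, IsDRegular (shift b k) ∧
      ∑ j, (shift b k j - (n - j : ℤ)).natAbs < ∑ j, (b j - (n - j : ℤ)).natAbs := by
  have hlt : ∀ (k : Fin n ⊕ Fin n) (i : Fin n), (∀ j ≠ i, shift b k j = b j) →
      (shift b k i - (n - i : ℤ)).natAbs < (b i - (n - i : ℤ)).natAbs →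
      ∑ j, (shift b k j - (n - j : ℤ)).natAbs < ∑ j, (b j - (n - j : ℤ)).natAbs := by
    intro k i h h'
    refine Finset.sum_lt_sum (fun j _ => ?_) ⟨i, Finset.mem_univ i, h'⟩
    by_cases hj : j = i
    · subst hj; exact h'.le
    · rw [h j hj]
  -- A nonpositive coordinate can only be the last one, and raising it stays regular. Otherwise
  -- every `b j` is at least its target `n - j`, and the last one above its target can be lowered.
  by_cases hneg : ∃ i, b i ≤ 0
  · obtain ⟨i, hi⟩ := hneg
    have hlast : ∀ j, j ≤ i := by
      intro j
      by_contra hij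
      have := hb i j (not_le.1 hij)
      omega
    refine ⟨Sum.inl i, (isDRegular_shift_inl hb i).2 fun j hj => ?_, hlt _ i (fun j hj => ?_) ?_⟩
    · have := hb j i hj; omega
    · simp [shift, hj]
    · have hin := i.2
      simp only [shift, Sum.elim_inl, Pi.add_apply, Pi.single_eq_same]; omega
  · push Not at hneg
    have hle : ∀ j : Fin n, (n : ℤ) - j ≤ b j := by
      have : ∀ d : ℕ, ∀ j : Fin n, n - 1 - j.val = d → (n : ℤ) - j ≤ b j := by
        intro d
        induction d with
        | zero => intro j hj; have := hneg j; omega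
        | succ d ih =>
          intro j hj
          have h1 := ih ⟨j + 1, by omega⟩ (by simp only; omega)
          have h2 := (hb j ⟨j + 1, by omega⟩ (Fin.lt_def.2 (Nat.lt_succ_self _))).1
          push_cast at h1
          omega
      exact fun j => this _ j rfl
    have hex : (Finset.univ.filter fun j : Fin n => b j ≠ (n : ℤ) - j).Nonempty := by
      obtain ⟨j, hj⟩ := Function.ne_iff.1 hne
      exact ⟨j, by simpa using hj⟩
    set i := Finset.max' _ hex with hi
    have hbi : b i ≠ (n : ℤ) - i := (Finset.mem_filter.1 (Finset.max'_mem _ hex)).2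
    have hafter : ∀ j, i < j → b j = (n : ℤ) - j := by
      intro j hij
      by_contra hj
      exact absurd (Finset.le_max' _ j (by simpa using hj)) (not_le.2 hij)
    have h1 := hle i
    have hin := i.2
    refine ⟨Sum.inr i, (isDRegular_shift_inr hb i).2 ⟨fun j hj => ?_, fun j hj => ?_⟩,
      hlt _ i (fun j hj => ?_) ?_⟩
    · have := hle j
      have := j.2
      omega
    · rw [hafter j hj]
      have := Fin.lt_def.1 hj
      omega
    · simp [shift, hj]
    · simp only [shift, Sum.elim_inr, Pi.sub_apply, Pi.single_eq_same]; omega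

/-- Induction on the distance to the oscillator weight: properness is known at the closer weight,
and the opposite shift carries it back. -/
theorem IsDRegular.vermaIdeal_ne_top {b : Fin n → ℤ} (hb : IsDRegular b) :
    vermaIdeal (wtOf b) ≠ ⊤ := by
  induction hd : ∑ j, (b j - (n - j : ℤ)).natAbs using Nat.strong_induction_on generalizing b with
  | _ d ih =>
    by_cases hne : b = fun j : Fin n => (n : ℤ) - j
    · subst hne
      exact SymplecticTensor.vermaIdeal_ne_top isSingular_oscillator
        (one_ne_zero (α := MvPolynomial (Fin n) ℂ))
    · obtain ⟨k, hk, hlt⟩ := hb.exists_shift hne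
      have h1 := ih _ (hd ▸ hlt) hk rfl
      have h2 := vermaIdeal_ne_top_shift hk k.swap (by rwa [shift_swap]) h1
      rwa [shift_swap] at h2

end Existence

/-! ### Assembly of the direct sum. -/

theorem exists_embedding {n : ℕ} {b : Fin n → ℤ} (hb : IsDRegular b) {v : L (wtOf b)}
    {φ : L (wtOf b) →ₗ[ℂ] ℂ} (h : IsSimpleHighestWeight (wtOf b) v φ) {k : Fin n ⊕ Fin n}
    (hk : IsDRegular (shift b k)) {lam : Wt n} (hlam : lam = wtOf b + wt k) :
    Nonempty (L lam ≃ₗ⁅ℂ, 𝔤 n⁆ casSpace (L (wtOf b)) (wtOf b) k) := by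
  subst hlam
  have h1 := isSimpleHighestWeight_casSpace h hb.cas_injective k
    ((leadCoeff_ne_zero_iff hb h k).2 hk)
  have h2 := hk.vermaIdeal_ne_top
  rw [wtOf_shift] at h2
  obtain ⟨v', φ', h'⟩ := exists_isSimpleHighestWeight_L h2
  exact h'.nonempty_equiv h1

end SymplecticTensor

end

open SymplecticTensor in
theorem theorem21 (n : ℕ) (hn : 2 ≤ n) (μ : Wt n) (hμ : μ ∈ A n) :
    (∀ lam ∈ Aof μ, LieModule.IsIrreducible ℂ (𝔤 n) (L lam)) ∧
    Nonempty ((L μ ⊗[ℂ] (Fin n ⊕ Fin n → ℂ)) ≃ₗ⁅ℂ, 𝔤 n⁆ (⨁ lam : Aof μ, L (lam : Wt n))) := by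
  classical
  obtain ⟨b, hb, rfl⟩ := exists_of_mem_A hn hμ
  have hy := hb.cas_injective
  refine ⟨fun lam hlam => ?_, ?_⟩
  · obtain ⟨b', hb', rfl⟩ := exists_of_mem_A hn hlam.1
    obtain ⟨v, φ, h⟩ := exists_isSimpleHighestWeight_L hb'.vermaIdeal_ne_top
    exact h.isIrreducible
  · obtain ⟨v, φ, h⟩ := exists_isSimpleHighestWeight_L hb.vermaIdeal_ne_top
    choose κ hκ hκreg using fun lam : Aof (wtOf b) => (mem_Aof_iff hn).1 lam.2
    have hκinj : Function.Injective κ := fun x y e => Subtype.ext (by rw [hκ x, hκ y, e])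
    have e := fun lam => (exists_embedding hb h (hκreg lam) (hκ lam)).some
    let f : (⨁ lam : Aof (wtOf b), L (lam : Wt n)) →ₗ[ℂ]
        (L (wtOf b) ⊗[ℂ] (Fin n ⊕ Fin n → ℂ)) :=
      DirectSum.toModule ℂ _ _ fun lam =>
        ((casSpace (L (wtOf b)) (wtOf b) (κ lam)).incl :
          casSpace (L (wtOf b)) (wtOf b) (κ lam) →ₗ[ℂ] _) ∘ₗ (e lam).toLinearEquiv.toLinearMap
    have hf : ∀ lam x, f (DirectSum.lof ℂ _ (fun lam : Aof (wtOf b) => L (lam : Wt n)) lam x) =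
        (e lam x : L (wtOf b) ⊗[ℂ] (Fin n ⊕ Fin n → ℂ)) := fun lam x => by
      simp only [f]
      rw [DirectSum.toModule_lof]
      rfl
    -- The Casimir projections recover the components of the direct sum, since distinct summands go
    -- to distinct eigenspaces; this gives injectivity.
    have hcomp : ∀ (x : ⨁ lam : Aof (wtOf b), L (lam : Wt n)) (lam : Aof (wtOf b)),
        casProj (L (wtOf b)) (wtOf b) (κ lam) (f x) = e lam (x lam) := by
      intro x lam
      induction x using DirectSum.induction_on with
      | zero => simp
      | of i x =>
        have h1 := hf i x
        rw [DirectSum.lof_eq_of] at h1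
        rw [h1, casProj_of_mem hy (e i x).2]
        by_cases hi : i = lam
        · subst hi; simp
        · rw [if_neg (fun h => hi (hκinj h)), DirectSum.of_eq_of_ne _ _ _ (Ne.symm hi)]; simp
      | add x y hx hy => rw [map_add, map_add, hx, hy]; simp
    have hlie : ∀ (X : 𝔤 n) (x : ⨁ lam : Aof (wtOf b), L (lam : Wt n)), f ⁅X, x⁆ = ⁅X, f x⁆ := by
      intro X x
      induction x using DirectSum.induction_on with
      | zero => simp
      | of i x =>
        have h2 : ⁅X, DirectSum.of (fun lam : Aof (wtOf b) => L (lam : Wt n)) i x⁆ =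
            DirectSum.of (fun lam : Aof (wtOf b) => L (lam : Wt n)) i ⁅X, x⁆ :=
          ((DirectSum.lieModuleOf ℂ (Aof (wtOf b)) (𝔤 n) (fun lam => L (lam : Wt n)) i).map_lie
            X x).symm
        rw [h2, ← DirectSum.lof_eq_of ℂ, ← DirectSum.lof_eq_of ℂ, hf, hf]
        exact congrArg Subtype.val ((e i).toLieModuleHom.map_lie X x)
      | add x y hx hy => rw [lie_add, map_add, map_add, lie_add, hx, hy]
    have hbij : Function.Bijective f := by
      constructor
      · rw [injective_iff_map_eq_zero]
        intro x hx
        refine DFinsupp.ext fun lam => ?_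
        have h1 := hcomp x lam
        rw [hx, map_zero] at h1
        have h2 : e lam (x lam) = 0 := Subtype.ext h1.symm
        have h3 := (e lam).injective (h2.trans (map_zero (e lam).toLieModuleHom).symm)
        exact h3
      · intro x
        -- Each projection of `x` lies either in the image of a summand or in an eigenspace that is
        -- zero, according to whether the shifted weight is in `A`; the projections sum to `x`.
        have hrange : ∀ k, casProj (L (wtOf b)) (wtOf b) k x ∈ LinearMap.range f := by
          intro k
          have hk := casProj_mem h.singular h.gen k x
          by_cases hreg : IsDRegular (shift b k)
          · let lam : Aof (wtOf b) := ⟨wtOf b + wt k, (mem_Aof_iff hn).2 ⟨k, rfl, hreg⟩⟩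
            have hkk : κ lam = k := by
              have h1 := hκ lam
              exact (wt_injective (add_left_cancel h1)).symm
            rw [← hkk] at hk ⊢
            obtain ⟨y, hy'⟩ := (e lam).surjective ⟨_, hk⟩
            exact ⟨_, (hf lam y).trans (congrArg Subtype.val hy')⟩
          · have h0 : leadCoeff (wtOf b) v φ k k = 0 := by
              by_contra h0
              exact hreg ((leadCoeff_ne_zero_iff hb h k).1 h0)
            rw [casSpace_eq_bot h hy k h0, LieSubmodule.mem_bot] at hk
            rw [hk]; exact zero_mem _
        have h1 := sum_casProj (by omega) hy x
        have h2 : x ∈ LinearMap.range f := by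
          rw [← h1]; exact sum_mem fun k _ => hrange k
        exact h2
    exact ⟨(lieModuleEquivOfBijective { f with map_lie' := fun {X x} => hlie X x } hbij).symm⟩
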